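/- **Definitions.** Let $\mathbb M$ be a finite alphabet and $\mathbb M^*$ its set of finite words, with empty word $\varepsilon$. A stationary stochastic process $(Y_t)_{t\in\mathbb N}$ over $\mathbb M$ is described by its word probabilities $p(u_1\dots u_\ell)=\Pr\{Y_t=u_1,\dots,Y_{t+\ell-1}=u_\ell\}$, which do not depend on $t$. A *quasi-realization* of $p$ is a quadruple $(V,\pi,D,\tau)$, where $V$ is a real vector space, $\tau\in V$, $\pi\in V^*$, and $D:\mathbb M^*\to\mathcal L(V)$ satisfies $D^{(\varepsilon)}=\mathrm{id}$ and $D^{(\mathbf u\mathbf v)}=D^{(\mathbf u)}D^{(\mathbf v)}$, such that $\pi\sum_{u\in\mathbb M}D^{(u)}=\pi$, $\sum_{u\in\mathbb M}D^{(u)}\tau=\tau$, and $p(\mathbf u)=\pi D^{(\mathbf u)}\tau$ for all words $\mathbf u$. It is *regular* if $\dim V$ is minimal among all quasi-realizations of $p$. A convex cone $\mathcal C\subset V$ is *stable* for $(V,\pi,D,\tau)$ if $\tau\in\mathcal C$, $D^{(\mathbf u)}(\mathcal C)\subseteq\mathcal C$ for all words $\mathbf u$, and $\pi(x)\ge 0$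 for all $x\in\mathcal C$. A *finite-dimensional quantum (HQMM) realization* of $p$ consists of a finite-dimensional complex Hilbert space $\mathcal H$, a density operator $\rho$ on $\mathcal H$, and completely positive maps $\mathcal E_u$ on $\mathcal B(\mathcal H)$, $u\in\mathbb M$, such that $\overline{\mathcal E}=\sum_u\mathcal E_u$ satisfies $\overline{\mathcal E}(\mathbb 1)=\mathbb 1$ and $\operatorname{Tr}(\rho\,\overline{\mathcal E}(X))=\operatorname{Tr}(\rho X)$ for all $X\in\mathcal B(\mathcal H)$, and $p(u_1\dots u_\ell)=\operatorname{Tr}\big(\rho\,\mathcal E_{u_1}\circ\dots\circ\mathcal E_{u_\ell}(\mathbb 1)\big)$ for all words. The *exponential cone* is $$\mathcal K_{\exp}=\Big\{x\in\mathbb R^3:\ x_2>0,\ \tfrac{x_1}{x_2}\ge e^{x_3/x_2}\Big\}\cup\{(x_1,0,x_3):x_1\ge0,\ x_3\le0\}.$$ **Theorem.** There are $\nu\in\mathbb R$, $a,b>0$ and $m_0,\mu_0\in\mathbb R^3$ such that, for $$D_1=\nu\begin{pmatrix}a&0&0\\0&1&0\\0&\ln a&1\end{pmatrix},\qquad D_2=\nu\begin{pmatrix}b&0&0\\0&1&0\\0&\ln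 b&1\end{pmatrix},\qquad D_0=\nu\,m_0\mu_0^T,$$ the matrix $\overline D=D_0+D_1+D_2$ has, uniquely up to scalar multiples, a left eigenvector $\pi$ and a right eigenvector $\tau$ with eigenvalue $1$, and, with a suitable normalization of $\pi$ and $\tau$ and with $D$ the homomorphism on words over $\{0,1,2\}$ generated by $D_0,D_1,D_2$: - $(\mathbb R^3,\pi,D,\tau)$ is a regular quasi-realization of a stationary stochastic process $p$ over the alphabet $\{0,1,2\}$; - $\mathcal K_{\exp}$ is a closed convex cone that is stable for $(\mathbb R^3,\pi,D,\tau)$, and it is the only one; - the process $p$ has no finite-dimensional quantum realization. Moreover, $\mathcal K_{\exp}$ is not semi-algebraic, i.e. it is not a finite Boolean combination of sets $\{x\in\mathbb R^3:f(x)>0\}$ with $f$ a real polynomial. -/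

import Mathlib

open scoped CStarAlgebra

noncomputable section

/-! ### Stationary processes over a finite alphabet, given by their word probabilities -/

/-- `p` gives the word probabilities of a stationary stochastic process `Y₀, Y₁, …` with values in
`α`: there is a law `P` on the paths `ℕ → α` such that, whatever the time `t`,
`p (u₁ … u_ℓ) = P (Y_t = u₁, …, Y_{t+ℓ-1} = u_ℓ)`. -/
def IsStationaryProcess {α : Type*} [MeasurableSpace α] (p : FreeMonoid α → ℝ) : Prop :=
  ∃ P : MeasureTheory.Measure (ℕ → α), MeasureTheory.IsProbabilityMeasure P ∧
    ∀ (t : ℕ) (w : FreeMonoid α),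
      P.real {y | ∀ i : Fin w.toList.length, y (t + i) = w.toList.get i} = p w

/-! ### Quasi-realizations -/

/-- `(V, π, D, τ)` is a quasi-realization of the stationary process with word probabilities `p`.
`D` is a homomorphism from the monoid of words to the linear maps of `V`. -/
structure IsQuasiRealization {α : Type*} [Fintype α] [MeasurableSpace α]
    {V : Type*} [AddCommGroup V] [Module ℝ V] (p : FreeMonoid α → ℝ)
    (π : Module.Dual ℝ V) (D : FreeMonoid α →* Module.End ℝ V) (τ : V) : Prop where
  process : IsStationaryProcess p
  left_fixed : π ∘ₗ (∑ u : α, D (FreeMonoid.of u)) = π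
  right_fixed : (∑ u : α, D (FreeMonoid.of u)) τ = τ
  prob : ∀ w : FreeMonoid α, p w = π (D w τ)

/-- A regular quasi-realization: one whose space has minimal dimension among all
quasi-realizations of the same process. -/
structure IsRegularQuasiRealization.{u, v} {α : Type v} [Fintype α] [MeasurableSpace α]
    {V : Type u} [AddCommGroup V] [Module ℝ V] (p : FreeMonoid α → ℝ)
    (π : Module.Dual ℝ V) (D : FreeMonoid α →* Module.End ℝ V) (τ : V) : Prop
    extends IsQuasiRealization p π D τ where
  minimal : ∀ (W : Type u) [AddCommGroup W] [Module ℝ W]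
    (π' : Module.Dual ℝ W) (D' : FreeMonoid α →* Module.End ℝ W) (τ' : W),
    IsQuasiRealization p π' D' τ' → Module.rank ℝ V ≤ Module.rank ℝ W

/-- A convex cone that is stable for `(V, π, D, τ)`: it contains `τ`, it is mapped into itself by
all `D w`, and `π` belongs to its dual cone. -/
structure IsStableCone {α V : Type*} [AddCommGroup V] [Module ℝ V]
    (π : Module.Dual ℝ V) (D : FreeMonoid α →* Module.End ℝ V) (τ : V)
    (C : ConvexCone ℝ V) : Prop where
  mem : τ ∈ C
  map_mem : ∀ (w : FreeMonoid α), ∀ x ∈ C, D w x ∈ C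
  dual : ∀ x ∈ C, 0 ≤ π x

/-! ### Quantum realizations -/

/-- The bounded operators on the `d`-dimensional complex Hilbert space. -/
abbrev QOp (d : ℕ) : Type :=
  EuclideanSpace ℂ (Fin d) →L[ℂ] EuclideanSpace ℂ (Fin d)

/-- The trace of an operator. -/
def qTrace {d : ℕ} (A : QOp d) : ℂ :=
  LinearMap.trace ℂ (EuclideanSpace ℂ (Fin d)) A.toLinearMap

/-- The composition of the maps `E u` along a word, `E (u₁ … u_ℓ) = E u₁ ∘ ⋯ ∘ E u_ℓ`. -/
def qWordMap {α : Type*} {d : ℕ} (E : α → (QOp d →CP QOp d)) :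
    FreeMonoid α →* Module.End ℂ (QOp d) :=
  FreeMonoid.lift fun u => (E u).toLinearMap

/-- A finite-dimensional quantum (completely positive, HQMM) realization of the process `p`:
completely positive maps `E u` on the operators of a finite-dimensional Hilbert space whose sum is
unital, and a density operator `ρ` that is stationary for the sum, such that
`p (w) = tr (ρ E_w (1))`. -/
def HasQuantumRealization {α : Type*} [Fintype α] (p : FreeMonoid α → ℝ) : Prop :=
  ∃ (d : ℕ) (ρ : QOp d) (E : α → (QOp d →CP QOp d)),
    ρ.IsPositive ∧ qTrace ρ = 1 ∧
    (∑ u : α, E u 1) = 1 ∧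
    (∀ X : QOp d, qTrace (ρ * ∑ u : α, E u X) = qTrace (ρ * X)) ∧
    ∀ w : FreeMonoid α, (p w : ℂ) = qTrace (ρ * qWordMap E w 1)

/-! ### Semi-algebraic sets -/

/-- Semi-algebraic sets: the finite Boolean combinations of the sets `{f > 0}`, `f` a real
polynomial in the coordinates. -/
def IsSemialgebraic {ι : Type*} (S : Set (ι → ℝ)) : Prop :=
  S ∈ BooleanSubalgebra.closure
    {T : Set (ι → ℝ) | ∃ f : MvPolynomial ι ℝ, T = {x | 0 < MvPolynomial.eval x f}}

/-! ### The exponential cone and the three maps -/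

/-- The exponential cone; `x 0, x 1, x 2` are the coordinates `x₁, x₂, x₃`. -/
def expCone : Set (Fin 3 → ℝ) :=
  {x | 0 < x 1 ∧ Real.exp (x 2 / x 1) ≤ x 0 / x 1} ∪ {x | x 1 = 0 ∧ 0 ≤ x 0 ∧ x 2 ≤ 0}

/-- The matrix `ν [[c, 0, 0], [0, 1, 0], [0, ln c, 1]]`. -/
def expMatrix (ν c : ℝ) : Matrix (Fin 3) (Fin 3) ℝ :=
  ν • !![c, 0, 0; 0, 1, 0; 0, Real.log c, 1]

/-- The rank-one reset `ν m μᵀ`. -/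
def resetMatrix (ν : ℝ) (m μ : Fin 3 → ℝ) : Matrix (Fin 3) (Fin 3) ℝ :=
  ν • Matrix.vecMulVec m μ

/-- The homomorphism on words over `{0, 1, 2}` generated by
`D₀ = ν m₀ μ₀ᵀ`, `D₁ = expMatrix ν a` and `D₂ = expMatrix ν b`. -/
def expD (ν a b : ℝ) (m₀ μ₀ : Fin 3 → ℝ) :
    FreeMonoid (Fin 3) →* Module.End ℝ (Fin 3 → ℝ) :=
  FreeMonoid.lift fun u =>
    Matrix.toLin' (![resetMatrix ν m₀ μ₀, expMatrix ν a, expMatrix ν b] u)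

/-- `D̄ = D₀ + D₁ + D₂`. -/
def expDbar (ν a b : ℝ) (m₀ μ₀ : Fin 3 → ℝ) : Module.End ℝ (Fin 3 → ℝ) :=
  ∑ u : Fin 3, expD ν a b m₀ μ₀ (FreeMonoid.of u)

end

/-! The parameters are a = 1/2, b = 3, m₀ = (1, 1, 0), μ₀ = (1, -1, -1). Up to the factor ν the
letters 1 and 2 act through a one-parameter group `expFlow s`; as log(1/2) and log 3 have opposite
signs and irrational ratio, the words in these letters reach a dense set of times s. The flow
carries m₀ along the curve (e^s, 1, s) and μ₀ along (e^s, -(1+s), -1). The closed convex cone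
generated by the first curve and the cone on which all functionals of the second are nonnegative
coincide: both are the exponential cone. A closed stable cone contains the first curve, by resetting
τ and then flowing (`expConvexCone_le`), and is nonnegative under the second, by flowing and then
resetting (`mem_expCone_of_forall_nonneg`). This gives uniqueness.

For a word w in the letters 1, 2 with time s, p(0w0) is a constant times ν^|w| f(s), where f(s) =
e^s - 1 - s. A quantum realization would thus give a semigroup of 2-positive maps, graded by a dense
set of times, with tr(Y F(X)) = f(s). In a model of least size both sides contain faithful elements,
so maps of bounded degree are bounded, and the degree-zero part of the closure is a compact
semigroup. If the unit also has least rank, that semigroup is a group, and some F of negative degree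
θ has a 2-positive inverse relative to the unit (`exists_isInvertibleModel`). The unit fixes a star
algebra, and equality in the Schwarz inequalities for F and its inverse, suitably normalized, yields
F(CᴴC) = (R C)ᴴ(R C) with R linear (`exists_root`). Hence f(kθ), which grows linearly in k, is the
squared Hilbert-Schmidt norm of a linear image of R^k A. That norm would grow like √k, which
iterates of a matrix never do (`bounded_iterate_of_sqrt_growth`).

The exponential cone is not semi-algebraic because a nonzero polynomial in s and e^s is eventually
nonzero. Membership in a semi-algebraic set is therefore eventually locally constant across the
curve (e^s, 1, s), which lies on the boundary of the cone. -/

noncomputable section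

open scoped Matrix.Norms.L2Operator MatrixOrder ComplexOrder
open Matrix

/-- The linear maps of a matrix algebra, with the operator norm. -/
abbrev MatrixEnd (n : Type*) [Fintype n] [DecidableEq n] : Type _ :=
  Matrix n n ℂ →L[ℂ] Matrix n n ℂ

/-! ### 2-positive maps of matrix algebras and their trace adjoints -/

section TwoPositive

set_option linter.unusedSectionVars false

variable {n m : Type*} [Fintype n] [DecidableEq n] [Fintype m] [DecidableEq m]

/-- `F` is 2-positive: `F ⊗ id₂` is positive. -/
def IsTwoPositive (F : MatrixEnd n) : Prop :=
  ∀ A B C D : Matrix n n ℂ, 0 ≤ fromBlocks A B C D →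
    0 ≤ fromBlocks (F A) (F B) (F C) (F D)

theorem fromBlocks_zero_nonneg_iff {A : Matrix n n ℂ} :
    0 ≤ fromBlocks A 0 0 (0 : Matrix m m ℂ) ↔ 0 ≤ A := by
  simp only [nonneg_iff_posSemidef]
  constructor
  · intro h
    exact h.submatrix (Sum.inl : n → n ⊕ m)
  · intro h
    have := h.conjTranspose_mul_mul_same (fromCols (1 : Matrix n n ℂ) (0 : Matrix n m ℂ))
    simpa [conjTranspose_fromCols_eq_fromRows_conjTranspose, fromRows_mul, mul_fromCols,
      ← fromCols_fromRows_eq_fromBlocks, fromCols_zero, fromRows_zero, Matrix.mul_assoc] using this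

theorem fromBlocks_gram_nonneg (A B : Matrix n n ℂ) :
    0 ≤ fromBlocks (Aᴴ * A) (Aᴴ * B) (Bᴴ * A) (Bᴴ * B) := by
  rw [nonneg_iff_posSemidef]
  have := posSemidef_conjTranspose_mul_self (fromBlocks A B 0 0 : Matrix (n ⊕ n) (n ⊕ n) ℂ)
  simpa [fromBlocks_conjTranspose, fromBlocks_multiply] using this

namespace IsTwoPositive

variable {F G : MatrixEnd n}

theorem map_nonneg (hF : IsTwoPositive F) {A : Matrix n n ℂ} (hA : 0 ≤ A) : 0 ≤ F A := by
  have := hF A 0 0 0 (fromBlocks_zero_nonneg_iff.2 hA)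
  rwa [map_zero, fromBlocks_zero_nonneg_iff] at this

theorem map_mono (hF : IsTwoPositive F) {A B : Matrix n n ℂ} (h : A ≤ B) : F A ≤ F B := by
  have := hF.map_nonneg (sub_nonneg.2 h)
  rwa [map_sub, sub_nonneg] at this

/-- The off-diagonal blocks of a positive block matrix are adjoint to each other; this is read off
from the image of the Gram block of 1 and A. -/
theorem map_conjTranspose (hF : IsTwoPositive F) (A : Matrix n n ℂ) : F Aᴴ = (F A)ᴴ := by
  have h := hF _ _ _ _ (fromBlocks_gram_nonneg 1 A)
  rw [nonneg_iff_posSemidef] at h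
  have h := h.isHermitian
  rw [isHermitian_fromBlocks_iff] at h
  simpa using h.2.1.symm

/-- Kadison's inequality: the Schur complement of the image of the Gram block of 1 and A. It fails
for maps that are only positive. -/
theorem schwarz (hF : IsTwoPositive F) (h1 : F 1 = 1) (A : Matrix n n ℂ) :
    (F A)ᴴ * F A ≤ F (Aᴴ * A) := by
  have h := hF _ _ _ _ (fromBlocks_gram_nonneg 1 A)
  have e : F (Aᴴ * 1) = (F A)ᴴ := by rw [← hF.map_conjTranspose]; simp
  rw [nonneg_iff_posSemidef, e] at h
  simp only [conjTranspose_one, one_mul, h1] at h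
  let : Invertible (1 : Matrix n n ℂ) := invertibleOne
  rw [Matrix.PosDef.fromBlocks₁₁ _ _ Matrix.PosDef.one] at h
  rw [le_iff]
  simpa using h

theorem comp (hF : IsTwoPositive F) (hG : IsTwoPositive G) : IsTwoPositive (F * G) :=
  fun _ _ _ _ h => hF _ _ _ _ (hG _ _ _ _ h)

theorem one : IsTwoPositive (1 : MatrixEnd n) := fun _ _ _ _ h => h

theorem smul (hF : IsTwoPositive F) {c : ℝ} (hc : 0 ≤ c) : IsTwoPositive ((c : ℂ) • F) := by
  intro A B C D h
  have := hF A B C D h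
  have h2 : 0 ≤ (c : ℂ) • fromBlocks (F A) (F B) (F C) (F D) := by
    rw [nonneg_iff_posSemidef] at this ⊢
    exact this.smul (by exact_mod_cast hc)
  simpa [fromBlocks_smul] using h2

end IsTwoPositive

theorem isClosed_isTwoPositive : IsClosed {F : MatrixEnd n | IsTwoPositive F} := by
  simp only [IsTwoPositive, Set.ofPred_forall]
  refine isClosed_iInter fun A => isClosed_iInter fun B => isClosed_iInter fun C =>
    isClosed_iInter fun D => isClosed_iInter fun _ => ?_
  refine IsClosed.preimage (f := fun F : MatrixEnd n => fromBlocks (F A) (F B) (F C) (F D)) ?_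
    CStarAlgebra.isClosed_nonneg
  refine Continuous.matrix_fromBlocks ?_ ?_ ?_ ?_ <;> fun_prop

/-- The map `A ↦ U F(V A Vᴴ) Uᴴ`. -/
def transportEnd (U : Matrix m n ℂ) (V : Matrix n m ℂ) (F : MatrixEnd n) : MatrixEnd m :=
  LinearMap.toContinuousLinearMap
    { toFun := fun A => U * F (V * A * Vᴴ) * Uᴴ
      map_add' := by intro A B; simp [Matrix.mul_add, Matrix.add_mul]
      map_smul' := by intro c A; simp }

@[simp]
theorem transportEnd_apply (U : Matrix m n ℂ) (V : Matrix n m ℂ) (F : MatrixEnd n)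
    (A : Matrix m m ℂ) : transportEnd U V F A = U * F (V * A * Vᴴ) * Uᴴ := rfl

theorem fromBlocks_conj_nonneg (U : Matrix m n ℂ) {A B C D : Matrix n n ℂ}
    (h : 0 ≤ fromBlocks A B C D) :
    0 ≤ fromBlocks (U * A * Uᴴ) (U * B * Uᴴ) (U * C * Uᴴ) (U * D * Uᴴ) := by
  rw [nonneg_iff_posSemidef] at h ⊢
  have := h.mul_mul_conjTranspose_same (fromBlocks U 0 0 U)
  simpa [fromBlocks_conjTranspose, fromBlocks_multiply] using this

theorem conj_nonneg (U : Matrix m n ℂ) {A : Matrix n n ℂ} (h : 0 ≤ A) : 0 ≤ U * A * Uᴴ := by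
  rw [nonneg_iff_posSemidef] at h ⊢
  exact h.mul_mul_conjTranspose_same U

theorem IsTwoPositive.transport {F : MatrixEnd n} (hF : IsTwoPositive F) (U : Matrix m n ℂ)
    (V : Matrix n m ℂ) : IsTwoPositive (transportEnd U V F) :=
  fun _ _ _ _ h => fromBlocks_conj_nonneg U (hF _ _ _ _ (fromBlocks_conj_nonneg V h))

theorem trace_mul_nonneg {A B : Matrix n n ℂ} (hA : 0 ≤ A) (hB : 0 ≤ B) :
    0 ≤ trace (A * B) := by
  obtain ⟨C, rfl⟩ := CStarAlgebra.nonneg_iff_eq_star_mul_self.1 hB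
  rw [← Matrix.mul_assoc, trace_mul_comm, ← Matrix.mul_assoc]
  exact (nonneg_iff_posSemidef.1 (conj_nonneg C hA)).trace_nonneg

/-- Self-duality of the positive cone: testing against rank-one matrices x xᴴ gives the quadratic
form. -/
theorem nonneg_of_trace_mul_nonneg {A : Matrix n n ℂ} (hA : A.IsHermitian)
    (h : ∀ B : Matrix n n ℂ, 0 ≤ B → 0 ≤ trace (A * B)) : 0 ≤ A := by
  rw [nonneg_iff_posSemidef]
  refine PosSemidef.of_dotProduct_mulVec_nonneg hA fun x => ?_
  have := h (vecMulVec x (star x)) (nonneg_iff_posSemidef.2 (posSemidef_vecMulVec_self_star x))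
  rwa [mul_vecMulVec, trace_vecMulVec, dotProduct_comm] at this

/-- The adjoint of `F` for the trace pairing. -/
def traceAdjoint (F : MatrixEnd n) : MatrixEnd n :=
  LinearMap.toContinuousLinearMap
    { toFun := fun A => Matrix.of fun i j => trace (A * F (single j i 1))
      map_add' := by intro A B; ext; simp [Matrix.add_mul]
      map_smul' := by intro c A; ext; simp }

theorem trace_traceAdjoint_mul (F : MatrixEnd n) (A B : Matrix n n ℂ) :
    trace (traceAdjoint F A * B) = trace (A * F B) := by
  let l : Matrix n n ℂ →ₗ[ℂ] ℂ := traceLinearMap n ℂ ℂ ∘ₗ LinearMap.mulLeft ℂ (traceAdjoint F A)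
  let r : Matrix n n ℂ →ₗ[ℂ] ℂ := traceLinearMap n ℂ ℂ ∘ₗ LinearMap.mulLeft ℂ A ∘ₗ F.toLinearMap
  have : l = r := by
    refine Matrix.ext_linearMap _ fun i j => LinearMap.ext_ring ?_
    simp [l, r, trace_mul_single, traceAdjoint]
  exact LinearMap.congr_fun this B

theorem eq_of_trace_mul_eq {A B : Matrix n n ℂ} (h : ∀ C, trace (A * C) = trace (B * C)) :
    A = B := by
  ext i j
  simpa [trace_mul_single] using h (single j i 1)

theorem traceAdjoint_mul (F G : MatrixEnd n) :
    traceAdjoint (F * G) = traceAdjoint G * traceAdjoint F := by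
  ext1 A
  refine eq_of_trace_mul_eq fun C => ?_
  simp only [mul_apply_eq_comp, trace_traceAdjoint_mul]

theorem trace_mul_traceAdjoint (F : MatrixEnd n) (A B : Matrix n n ℂ) :
    trace (A * traceAdjoint F B) = trace (F A * B) := by
  rw [trace_mul_comm, trace_traceAdjoint_mul, trace_mul_comm]

theorem IsTwoPositive.traceAdjoint_map_conjTranspose {F : MatrixEnd n} (hF : IsTwoPositive F)
    (A : Matrix n n ℂ) : traceAdjoint F Aᴴ = (traceAdjoint F A)ᴴ := by
  refine eq_of_trace_mul_eq fun C => ?_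
  rw [trace_traceAdjoint_mul, ← star_inj, ← trace_conjTranspose, ← trace_conjTranspose,
    conjTranspose_mul, conjTranspose_mul, conjTranspose_conjTranspose, conjTranspose_conjTranspose,
    ← hF.map_conjTranspose, trace_mul_traceAdjoint]

theorem trace_fromBlocks_mul (A B C D A' B' C' D' : Matrix n n ℂ) :
    trace (fromBlocks A B C D * fromBlocks A' B' C' D') =
      trace (A * A') + trace (B * C') + (trace (C * B') + trace (D * D')) := by
  simp [fromBlocks_multiply, trace, Fintype.sum_sum_type, Finset.sum_add_distrib, add_assoc]

/-- Self-duality of the positive cone of 2×2 block matrices, since the trace pairing of blocks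
splits into the pairings of the entries. -/
theorem IsTwoPositive.traceAdjoint {F : MatrixEnd n} (hF : IsTwoPositive F) :
    IsTwoPositive (traceAdjoint F) := by
  intro A B C D h
  have hh := (nonneg_iff_posSemidef.1 h).isHermitian
  rw [isHermitian_fromBlocks_iff] at hh
  refine nonneg_of_trace_mul_nonneg ?_ fun P hP => ?_
  · rw [isHermitian_fromBlocks_iff]
    refine ⟨?_, ?_, ?_, ?_⟩
    · exact (hF.traceAdjoint_map_conjTranspose A).symm.trans (by rw [hh.1.eq])
    · exact (hF.traceAdjoint_map_conjTranspose B).symm.trans (by rw [hh.2.1])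
    · exact (hF.traceAdjoint_map_conjTranspose C).symm.trans (by rw [hh.2.2.1])
    · exact (hF.traceAdjoint_map_conjTranspose D).symm.trans (by rw [hh.2.2.2.eq])
  · rw [← fromBlocks_toBlocks P] at hP ⊢
    have := trace_mul_nonneg h (hF _ _ _ _ hP)
    rw [trace_fromBlocks_mul] at this ⊢
    simpa only [trace_traceAdjoint_mul] using this

theorem MatrixEnd.ext_nonneg {F G : Matrix n n ℂ →ₗ[ℂ] Matrix m m ℂ}
    (h : ∀ A, 0 ≤ A → F A = G A) : F = G :=
  LinearMap.ext_on_range (v := fun A : {A : Matrix n n ℂ // 0 ≤ A} => (A : Matrix n n ℂ))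
    (by rw [Subtype.range_coe_subtype]; exact CStarAlgebra.span_nonneg) fun A => h A A.2

end TwoPositive
end

noncomputable section

open scoped Matrix.Norms.L2Operator MatrixOrder ComplexOrder
open Matrix

/-! ### Graded semigroups of 2-positive maps and reduction to minimal size -/

section Model

set_option linter.unusedSectionVars false

variable {n m : Type*} [Fintype n] [DecidableEq n] [Fintype m] [DecidableEq m]

/-- A graded semigroup `S` of 2-positive maps with unit `e`, and positive matrices `X`, `Y` such
that `tr (Y F(X)) = f s` for every `F` of degree `s`, the degrees being dense in `ℝ`. -/
structure IsPositiveModel (f : ℝ → ℝ) (S : Set (MatrixEnd n × ℝ)) (e : MatrixEnd n)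
    (X Y : Matrix n n ℂ) : Prop where
  isTwoPositive : ∀ p ∈ S, IsTwoPositive p.1
  mul_mem : ∀ p ∈ S, ∀ q ∈ S, (p.1 * q.1, p.2 + q.2) ∈ S
  unit_mem : (e, 0) ∈ S
  unit_mul : ∀ p ∈ S, e * p.1 = p.1
  mul_unit : ∀ p ∈ S, p.1 * e = p.1
  nonneg_left : 0 ≤ X
  nonneg_right : 0 ≤ Y
  unit_left : e X = X
  unit_right : traceAdjoint e Y = Y
  trace_eq : ∀ p ∈ S, trace (Y * p.1 X) = (f p.2 : ℂ)
  dense : Dense (Prod.snd '' S)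

/-- The cone of the sums of the `F(X)`, `F ∈ S`. -/
def orbitSums (S : Set (MatrixEnd n × ℝ)) (X : Matrix n n ℂ) : AddSubmonoid (Matrix n n ℂ) :=
  AddSubmonoid.closure ((fun p : MatrixEnd n × ℝ => p.1 X) '' S)

/-- The graded semigroup of the trace adjoints. -/
def adjointMaps (S : Set (MatrixEnd n × ℝ)) : Set (MatrixEnd n × ℝ) :=
  (fun p => (traceAdjoint p.1, p.2)) '' S

/-- The graded semigroup of the maps `A ↦ U F(V A Vᴴ) Uᴴ`. -/
def transportMaps (U : Matrix m n ℂ) (V : Matrix n m ℂ) (S : Set (MatrixEnd n × ℝ)) :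
    Set (MatrixEnd m × ℝ) :=
  (fun p => (transportEnd U V p.1, p.2)) '' S

/-- The columns of V are the eigenvectors with nonzero eigenvalue, scaled by the root of the
eigenvalue, and U is a left inverse. This serves to compress a model to the support of A, which is
strictly smaller. -/
theorem exists_factorization_of_not_posDef {A : Matrix n n ℂ} (hA : 0 ≤ A) (h : ¬ A.PosDef) :
    ∃ s : Set n, ∃ _ : DecidablePred (· ∈ s), Fintype.card s < Fintype.card n ∧
      ∃ (U : Matrix s n ℂ) (V : Matrix n s ℂ), U * V = 1 ∧ V * Vᴴ = A := by
  classical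
  rw [nonneg_iff_posSemidef] at hA
  have hH := hA.isHermitian
  set l := hH.eigenvalues with hl
  have hl0 : ∀ i, 0 ≤ l i := hA.eigenvalues_nonneg
  set W : Matrix n n ℂ := hH.eigenvectorUnitary.1 with hW
  have hWW : Wᴴ * W = 1 := by
    have := (hH.eigenvectorUnitary).2
    exact (Matrix.mem_unitaryGroup_iff').1 this
  have hsp : A = W * diagonal (fun i => (l i : ℂ)) * Wᴴ := by
    have := hH.spectral_theorem
    simpa [Unitary.conjStarAlgAut_apply, hW, star_eq_conjTranspose, Function.comp_def] using this
  let s : Set n := {i | l i ≠ 0}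
  have hlt : ∃ i, l i = 0 := by
    by_contra! hne
    exact h (hH.posDef_iff_eigenvalues_pos.2 fun i => (hl0 i).lt_of_ne (hne i).symm)
  obtain ⟨i₀, hi₀⟩ := hlt
  refine ⟨s, inferInstance, Fintype.card_subtype_lt (x := i₀) (by simp [s, hi₀]),
    Matrix.of fun j i => ((Real.sqrt (l j))⁻¹ : ℂ) * star (W i j),
    Matrix.of fun i j => W i j * (Real.sqrt (l j) : ℂ), ?_, ?_⟩
  · ext j k
    have h1 : ∑ i, star (W i j) * W i k = (1 : Matrix n n ℂ) j k := by
      rw [← hWW]; simp [mul_apply]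
    have h2 : ((Real.sqrt (l k) : ℝ) : ℂ) ≠ 0 := by
      have : 0 < Real.sqrt (l k) := Real.sqrt_pos.2 ((hl0 k).lt_of_ne (Ne.symm k.2))
      exact_mod_cast this.ne'
    have : ∑ i, ((Real.sqrt (l j))⁻¹ : ℂ) * star (W i j) * (W i k * (Real.sqrt (l k) : ℂ))
        = ((Real.sqrt (l j))⁻¹ : ℂ) * (Real.sqrt (l k) : ℂ) * (1 : Matrix n n ℂ) j k := by
      rw [← h1, Finset.mul_sum]
      exact Finset.sum_congr rfl fun i _ => by ring
    rw [mul_apply]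
    simp only [of_apply]
    rw [this]
    by_cases hjk : j = k
    · subst hjk; simp [h2]
    · rw [one_apply_ne hjk, one_apply_ne (fun h => hjk (Subtype.ext h)), mul_zero]
  · rw [hsp]
    ext i j
    simp only [mul_apply, of_apply, conjTranspose_apply, diagonal_apply, mul_ite, mul_zero,
      Finset.sum_ite_eq', Finset.mem_univ, if_true]
    have : ∀ k, W i k * (Real.sqrt (l k) : ℂ) * star (W j k * (Real.sqrt (l k) : ℂ))
        = W i k * (l k : ℂ) * star (W j k) := by
      intro k
      have : (Real.sqrt (l k) : ℂ) * (Real.sqrt (l k) : ℂ) = (l k : ℂ) := by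
        exact_mod_cast Real.mul_self_sqrt (hl0 k)
      rw [star_mul', ← this]
      simp only [Complex.star_def, Complex.conj_ofReal]
      ring
    simp only [this]
    rw [← Finset.sum_subtype (Finset.univ.filter (· ∈ s)) (by simp)
      (fun k => W i k * (l k : ℂ) * star (W j k))]
    apply Finset.sum_filter_of_ne
    intro k _ hk hlk
    exact hk (by rw [hlk]; simp)

theorem mulVec_eq_zero_of_le {A B : Matrix n n ℂ} (hA : 0 ≤ A) (h : A ≤ B) {v : n → ℂ}
    (hv : B *ᵥ v = 0) : A *ᵥ v = 0 := by
  rw [nonneg_iff_posSemidef] at hA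
  rw [le_iff] at h
  rw [← hA.dotProduct_mulVec_zero_iff]
  have h1 := hA.dotProduct_mulVec_nonneg v
  have h2 := h.dotProduct_mulVec_nonneg v
  rw [sub_mulVec, hv, zero_sub, dotProduct_neg] at h2
  exact le_antisymm (neg_nonneg.1 h2) h1

/-- Take x with kernel of least dimension. The kernel of x + z lies in that of x, hence equals it,
and it also lies in that of z. So x has the largest support. -/
theorem exists_maximal_kernel (O : AddSubmonoid (Matrix n n ℂ)) (hO : ∀ x ∈ O, 0 ≤ x) :
    ∃ x ∈ O, ∀ z ∈ O, ∀ v, x *ᵥ v = 0 → z *ᵥ v = 0 := by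
  obtain ⟨x, hx, hmin⟩ := (measure fun x : Matrix n n ℂ =>
    Module.finrank ℂ (LinearMap.ker x.mulVecLin)).wf.has_min (O : Set (Matrix n n ℂ)) ⟨0, O.zero_mem⟩
  refine ⟨x, hx, fun z hz v hv => ?_⟩
  have hk : LinearMap.ker (x + z).mulVecLin ≤ LinearMap.ker x.mulVecLin := fun w hw =>
    mulVec_eq_zero_of_le (hO x hx) (le_add_of_nonneg_right (hO z hz)) hw
  have heq := Submodule.eq_of_le_of_finrank_le hk (not_lt.1 (hmin _ (O.add_mem hx hz)))
  have : v ∈ LinearMap.ker (x + z).mulVecLin := by rw [heq]; exact hv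
  exact mulVec_eq_zero_of_le (hO z hz) (le_add_of_nonneg_left (hO x hx)) this

/-- The matrix 1 - UᴴVᴴ is killed by x, hence by z: a matrix supported on the support of x survives
compression and re-expansion. -/
theorem mul_projection_eq {x z : Matrix n n ℂ} {U : Matrix m n ℂ} {V : Matrix n m ℂ}
    (hUV : U * V = 1) (hV : V * Vᴴ = x) (hz : z.IsHermitian)
    (h : ∀ v, x *ᵥ v = 0 → z *ᵥ v = 0) : V * (U * z * Uᴴ) * Vᴴ = z := by
  have h1 : z * (Uᴴ * Vᴴ) = z := by
    suffices hz0 : z * (1 - Uᴴ * Vᴴ) = 0 by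
      rw [Matrix.mul_sub, Matrix.mul_one, sub_eq_zero] at hz0
      exact hz0.symm
    have : x * (1 - Uᴴ * Vᴴ) = 0 := by
      rw [← hV, Matrix.mul_sub, Matrix.mul_one, Matrix.mul_assoc, ← Matrix.mul_assoc Vᴴ,
        ← conjTranspose_mul, hUV]
      simp
    refine Matrix.ext_of_mulVec_single fun j => ?_
    rw [← mulVec_mulVec, zero_mulVec]
    exact h _ (by rw [mulVec_mulVec, this, zero_mulVec])
  have h2 : V * U * z = z := by
    have := congrArg conjTranspose h1
    simpa [conjTranspose_mul, hz.eq, Matrix.mul_assoc] using this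
  calc V * (U * z * Uᴴ) * Vᴴ = V * U * z * (Uᴴ * Vᴴ) := by simp only [Matrix.mul_assoc]
    _ = z := by rw [h2, h1]

theorem traceAdjoint_traceAdjoint (F : MatrixEnd n) : traceAdjoint (traceAdjoint F) = F := by
  ext1 A
  refine eq_of_trace_mul_eq fun C => ?_
  rw [trace_traceAdjoint_mul, trace_mul_traceAdjoint]

theorem map_mem_orbitSums {S : Set (MatrixEnd n × ℝ)} {X : Matrix n n ℂ}
    (hS : ∀ p ∈ S, ∀ q ∈ S, (p.1 * q.1, p.2 + q.2) ∈ S) {p : MatrixEnd n × ℝ} (hp : p ∈ S)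
    {x : Matrix n n ℂ} (hx : x ∈ orbitSums S X) : p.1 x ∈ orbitSums S X := by
  induction hx using AddSubmonoid.closure_induction with
  | mem x hx =>
    obtain ⟨q, hq, rfl⟩ := hx
    exact AddSubmonoid.subset_closure ⟨_, hS p hp q hq, rfl⟩
  | zero => rw [map_zero]; exact zero_mem _
  | add x y _ _ hx hy => rw [map_add]; exact add_mem hx hy

theorem le_norm_smul_one {A : Matrix n n ℂ} (hA : 0 ≤ A) : A ≤ ((‖A‖ : ℝ) : ℂ) • 1 := by
  have := IsSelfAdjoint.le_algebraMap_norm_self (a := A) (IsSelfAdjoint.of_nonneg hA)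
  rwa [Algebra.algebraMap_eq_smul_one, ← Complex.coe_smul] at this

namespace IsPositiveModel

variable {f : ℝ → ℝ} {S : Set (MatrixEnd n × ℝ)} {e : MatrixEnd n} {X Y : Matrix n n ℂ}

theorem mem_orbitSums (h : IsPositiveModel f S e X Y) : X ∈ orbitSums S X :=
  AddSubmonoid.subset_closure ⟨_, h.unit_mem, h.unit_left⟩

theorem orbitSums_nonneg (h : IsPositiveModel f S e X Y) {x : Matrix n n ℂ}
    (hx : x ∈ orbitSums S X) : 0 ≤ x := by
  induction hx using AddSubmonoid.closure_induction with
  | mem x hx =>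
    obtain ⟨q, hq, rfl⟩ := hx
    exact (h.isTwoPositive q hq).map_nonneg h.nonneg_left
  | zero => exact le_rfl
  | add x y _ _ hx hy => exact add_nonneg hx hy

theorem unit_orbitSums (h : IsPositiveModel f S e X Y) {x : Matrix n n ℂ}
    (hx : x ∈ orbitSums S X) : e x = x := by
  induction hx using AddSubmonoid.closure_induction with
  | mem x hx =>
    obtain ⟨q, hq, rfl⟩ := hx
    exact congrArg (fun G : MatrixEnd n => G X) (h.unit_mul q hq)
  | zero => exact map_zero _
  | add x y _ _ hx hy => rw [map_add, hx, hy]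

/-- Passing to adjoints exchanges X and Y, so results about orbits of X also hold for Y. Products
are reversed, which is harmless because degrees commute. -/
theorem adjoint (h : IsPositiveModel f S e X Y) :
    IsPositiveModel f (adjointMaps S) (traceAdjoint e) Y X where
  isTwoPositive := by
    rintro _ ⟨p, hp, rfl⟩
    exact (h.isTwoPositive p hp).traceAdjoint
  mul_mem := by
    rintro _ ⟨p, hp, rfl⟩ _ ⟨q, hq, rfl⟩
    exact ⟨_, h.mul_mem q hq p hp, Prod.ext (traceAdjoint_mul _ _) (add_comm _ _)⟩
  unit_mem := ⟨_, h.unit_mem, rfl⟩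
  unit_mul := by
    rintro _ ⟨p, hp, rfl⟩
    simp only
    rw [← traceAdjoint_mul, h.mul_unit p hp]
  mul_unit := by
    rintro _ ⟨p, hp, rfl⟩
    simp only
    rw [← traceAdjoint_mul, h.unit_mul p hp]
  nonneg_left := h.nonneg_right
  nonneg_right := h.nonneg_left
  unit_left := h.unit_right
  unit_right := by rw [traceAdjoint_traceAdjoint, h.unit_left]
  trace_eq := by
    rintro _ ⟨p, hp, rfl⟩
    rw [trace_mul_traceAdjoint, trace_mul_comm, h.trace_eq p hp]
  dense := by
    rw [adjointMaps, Set.image_image]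
    exact h.dense

/-- Compression need not be multiplicative; it is so here because `hS` makes it lossless on all
values of the maps. -/
theorem transport (h : IsPositiveModel f S e X Y) {U : Matrix m n ℂ} {V : Matrix n m ℂ}
    (hS : ∀ p ∈ S, ∀ A : Matrix m m ℂ, V * (U * p.1 (V * A * Vᴴ) * Uᴴ) * Vᴴ = p.1 (V * A * Vᴴ))
    (hX : V * (U * X * Uᴴ) * Vᴴ = X) :
    IsPositiveModel f (transportMaps U V S) (transportEnd U V e) (U * X * Uᴴ) (Vᴴ * Y * V) := by
  have hmul : ∀ p ∈ S, ∀ q ∈ S, transportEnd U V p.1 * transportEnd U V q.1 =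
      transportEnd U V (p.1 * q.1) := by
    intro p hp q hq
    ext1 A
    simp only [mul_apply_eq_comp, transportEnd_apply, hS q hq]
  refine
    { isTwoPositive := ?_
      mul_mem := ?_
      unit_mem := ⟨_, h.unit_mem, rfl⟩
      unit_mul := ?_
      mul_unit := ?_
      nonneg_left := conj_nonneg U h.nonneg_left
      nonneg_right := by simpa using conj_nonneg Vᴴ h.nonneg_right
      unit_left := ?_
      unit_right := ?_
      trace_eq := ?_
      dense := ?_ }
  · rintro _ ⟨p, hp, rfl⟩
    exact (h.isTwoPositive p hp).transport U V
  · rintro _ ⟨p, hp, rfl⟩ _ ⟨q, hq, rfl⟩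
    exact ⟨_, h.mul_mem p hp q hq, Prod.ext (hmul p hp q hq).symm rfl⟩
  · rintro _ ⟨p, hp, rfl⟩
    exact (hmul _ h.unit_mem p hp).trans (by rw [h.unit_mul p hp])
  · rintro _ ⟨p, hp, rfl⟩
    exact (hmul p hp _ h.unit_mem).trans (by rw [h.mul_unit p hp])
  · rw [transportEnd_apply, hX, h.unit_left]
  · refine eq_of_trace_mul_eq fun C => ?_
    have h1 : ∀ Z : Matrix n n ℂ, trace (Y * e Z) = trace (Y * Z) := fun Z => by
      rw [← trace_traceAdjoint_mul, h.unit_right]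
    have h2 : ∀ Z : Matrix m m ℂ, trace (Vᴴ * Y * V * Z) = trace (Y * (V * Z * Vᴴ)) := fun Z => by
      rw [Matrix.mul_assoc, Matrix.mul_assoc, trace_mul_comm]
      simp only [Matrix.mul_assoc]
    rw [trace_traceAdjoint_mul, h2, transportEnd_apply, hS (e, 0) h.unit_mem, h1, h2]
  · rintro _ ⟨p, hp, rfl⟩
    rw [transportEnd_apply, hX, Matrix.mul_assoc, Matrix.mul_assoc, trace_mul_comm,
      ← h.trace_eq p hp]
    have := hS p hp (U * X * Uᴴ)
    rw [hX] at this
    conv_rhs => rw [← this]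
    simp only [Matrix.mul_assoc]
  · rw [transportMaps, Set.image_image]
    exact h.dense

/-- In a model of minimal size the orbit sums contain a positive definite matrix. -/
theorem exists_posDef (h : IsPositiveModel f S e X Y)
    (hmin : ∀ (s : Set n) (_ : DecidablePred (· ∈ s)) (T : Set (MatrixEnd s × ℝ))
      (e' : MatrixEnd s) (X' Y' : Matrix s s ℂ), IsPositiveModel f T e' X' Y' →
      Fintype.card n ≤ Fintype.card s) :
    ∃ x ∈ orbitSums S X, x.PosDef := by
  obtain ⟨x, hx, hker⟩ := exists_maximal_kernel (orbitSums S X) fun x hx => h.orbitSums_nonneg hx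
  refine ⟨x, hx, ?_⟩
  by_contra hpd
  obtain ⟨s, ds, hs, U, V, hUV, hV⟩ :=
    exists_factorization_of_not_posDef (h.orbitSums_nonneg hx) hpd
  refine hs.not_ge (hmin s ds _ _ _ _ (h.transport (U := U) (V := V) ?_ ?_))
  · intro p hp A
    have hF := h.isTwoPositive p hp
    let Φ : Matrix s s ℂ →ₗ[ℂ] Matrix n n ℂ :=
      { toFun := fun A => V * (U * p.1 (V * A * Vᴴ) * Uᴴ) * Vᴴ
        map_add' := by intro A B; simp [Matrix.mul_add, Matrix.add_mul]
        map_smul' := by intro c A; simp }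
    let Ψ : Matrix s s ℂ →ₗ[ℂ] Matrix n n ℂ :=
      { toFun := fun A => p.1 (V * A * Vᴴ)
        map_add' := by intro A B; simp [Matrix.mul_add, Matrix.add_mul]
        map_smul' := by intro c A; simp }
    suffices Φ = Ψ from LinearMap.congr_fun this A
    refine MatrixEnd.ext_nonneg fun A hA => ?_
    have h0 : 0 ≤ p.1 (V * A * Vᴴ) := hF.map_nonneg (conj_nonneg V hA)
    refine mul_projection_eq hUV hV (nonneg_iff_posSemidef.1 h0).isHermitian fun v hv => ?_
    -- The input is dominated by a multiple of x, so its image is dominated by the same multiple of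
    -- F(x). As F(x) is again an orbit sum, the image is supported on the support of x.
    have h1 : V * A * Vᴴ ≤ ((‖A‖ : ℝ) : ℂ) • x := by
      have := conj_nonneg V (sub_nonneg.2 (le_norm_smul_one hA))
      rw [Matrix.mul_sub, Matrix.sub_mul, sub_nonneg] at this
      simpa [hV] using this
    refine mulVec_eq_zero_of_le h0 (hF.map_mono h1) ?_
    rw [map_smul, smul_mulVec, hker _ (map_mem_orbitSums h.mul_mem hp hx) v hv, smul_zero]
  · exact mul_projection_eq hUV hV (nonneg_iff_posSemidef.1 h.nonneg_left).isHermitian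
      fun v hv => hker _ h.mem_orbitSums v hv

end IsPositiveModel

end Model
end

noncomputable section

open scoped Matrix.Norms.L2Operator MatrixOrder ComplexOrder
open Matrix

/-! ### Norm bounds from faithful orbit sums, closures and corners -/

section Minimal

set_option linter.unusedSectionVars false

variable {n m : Type*} [Fintype n] [DecidableEq n] [Fintype m] [DecidableEq m]

theorem exists_one_le_smul {A : Matrix n n ℂ} (hA : A.PosDef) :
    ∃ c : ℝ, 0 ≤ c ∧ 1 ≤ (c : ℂ) • A := by
  obtain ⟨C, hC⟩ :=
    CStarAlgebra.nonneg_iff_eq_star_mul_self.1 (nonneg_iff_posSemidef.2 hA.posSemidef)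
  rw [star_eq_conjTranspose] at hC
  have hu : IsUnit C.det := by
    have := (isUnit_iff_isUnit_det A).1 hA.isUnit
    rw [hC, det_mul] at this
    exact (IsUnit.mul_iff.1 this).2
  -- Conjugating N ≤ ‖N‖ by C turns the left side into 1 and the right side into ‖N‖ A.
  set N := (C⁻¹)ᴴ * C⁻¹ with hN
  have h0 : 0 ≤ N := star_mul_self_nonneg C⁻¹
  refine ⟨‖N‖, norm_nonneg _, ?_⟩
  have := conj_nonneg Cᴴ (sub_nonneg.2 (le_norm_smul_one h0))
  rw [Matrix.mul_sub, Matrix.sub_mul, sub_nonneg, conjTranspose_conjTranspose] at this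
  convert this using 1
  · rw [hN]
    have h1 : Cᴴ * (C⁻¹)ᴴ = 1 := by
      rw [← conjTranspose_mul, nonsing_inv_mul _ hu, conjTranspose_one]
    rw [← Matrix.mul_assoc, h1, Matrix.one_mul, nonsing_inv_mul _ hu]
  · simp [hC]

theorem norm_le_re_trace {A : Matrix n n ℂ} (hA : 0 ≤ A) : ‖A‖ ≤ (trace A).re := by
  have hp := nonneg_iff_posSemidef.1 hA
  rcases isEmpty_or_nonempty n with hn | hn
  · simp [Subsingleton.elim A 0]
  · have h1 : ‖A‖ ∈ spectrum ℝ A := CStarAlgebra.norm_mem_spectrum_of_nonneg hA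
    rw [hp.isHermitian.spectrum_real_eq_range_eigenvalues] at h1
    obtain ⟨i, hi⟩ := h1
    rw [← hi, hp.isHermitian.trace_eq_sum_eigenvalues]
    have := Finset.single_le_sum (f := hp.isHermitian.eigenvalues)
      (fun j _ => hp.eigenvalues_nonneg j) (Finset.mem_univ i)
    simpa using this

theorem exists_norm_le_mul_trace {y : Matrix n n ℂ} (hy : y.PosDef) :
    ∃ c : ℝ, 0 ≤ c ∧ ∀ A : Matrix n n ℂ, 0 ≤ A → ‖A‖ ≤ c * ‖trace (y * A)‖ := by
  obtain ⟨c, hc, h⟩ := exists_one_le_smul hy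
  refine ⟨c, hc, fun A hA => (norm_le_re_trace hA).trans ?_⟩
  have h1 := trace_mul_nonneg (sub_nonneg.2 h) hA
  rw [Matrix.sub_mul, trace_sub, sub_nonneg, Matrix.one_mul, Matrix.smul_mul, trace_smul] at h1
  have h2 := (Complex.le_def.1 h1).1
  refine h2.trans ((Complex.re_le_norm _).trans ?_)
  rw [smul_eq_mul, norm_mul, Complex.norm_real, Real.norm_of_nonneg hc]

namespace IsPositiveModel

variable {f : ℝ → ℝ} {S : Set (MatrixEnd n × ℝ)} {e : MatrixEnd n} {X Y : Matrix n n ℂ}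

/-- For x and y sums of orbit elements the trace is a finite sum of values of f at boundedly shifted
degrees, and f is bounded on compact intervals. -/
theorem exists_trace_bound (h : IsPositiveModel f S e X Y) (hf : Continuous f)
    {x y : Matrix n n ℂ} (hx : x ∈ orbitSums S X) (hy : y ∈ orbitSums (adjointMaps S) Y) (R : ℝ) :
    ∃ C : ℝ, ∀ p ∈ S, |p.2| ≤ R → ‖trace (y * p.1 x)‖ ≤ C := by
  induction hx using AddSubmonoid.closure_induction with
  | mem x hx =>
    obtain ⟨q, hq, rfl⟩ := hx
    induction hy using AddSubmonoid.closure_induction with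
    | mem y hy =>
      obtain ⟨_, ⟨r, hr, rfl⟩, rfl⟩ := hy
      obtain ⟨C, hC⟩ := (isCompact_Icc (a := -R) (b := R)).exists_bound_of_continuousOn
        (f := fun t => f (r.2 + (t + q.2))) (by fun_prop)
      refine ⟨C, fun p hp hpR => ?_⟩
      have := h.trace_eq _ (h.mul_mem r hr _ (h.mul_mem p hp q hq))
      simp only [trace_traceAdjoint_mul]
      simp only [mul_apply_eq_comp] at this
      rw [this, Complex.norm_real]
      exact hC _ (abs_le.1 hpR)
    | zero => exact ⟨0, fun p _ _ => by simp⟩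
    | add y z _ _ hy hz =>
      obtain ⟨C, hC⟩ := hy
      obtain ⟨C', hC'⟩ := hz
      refine ⟨C + C', fun p hp hpR => ?_⟩
      rw [Matrix.add_mul, trace_add]
      exact (norm_add_le _ _).trans (add_le_add (hC p hp hpR) (hC' p hp hpR))
  | zero => exact ⟨0, fun p _ _ => by simp⟩
  | add y z _ _ hy hz =>
    obtain ⟨C, hC⟩ := hy
    obtain ⟨C', hC'⟩ := hz
    refine ⟨C + C', fun p hp hpR => ?_⟩
    rw [map_add, Matrix.mul_add, trace_add]
    exact (norm_add_le _ _).trans (add_le_add (hC p hp hpR) (hC' p hp hpR))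

/-- For A ≥ 0, domination of A by a multiple of x bounds ‖F(A)‖ by ‖F(x)‖, and the faithful
functional y bounds ‖F(x)‖ by tr(y F(x)). Positive matrices span, and the uniform boundedness
principle turns pointwise bounds into a norm bound. -/
theorem exists_norm_bound (h : IsPositiveModel f S e X Y) (hf : Continuous f)
    {x y : Matrix n n ℂ} (hx : x ∈ orbitSums S X) (hxp : x.PosDef)
    (hy : y ∈ orbitSums (adjointMaps S) Y) (hyp : y.PosDef) (R : ℝ) :
    ∃ C : ℝ, ∀ p ∈ S, |p.2| ≤ R → ‖p.1‖ ≤ C := by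
  obtain ⟨C, hC⟩ := h.exists_trace_bound hf hx hy R
  obtain ⟨c, hc, hc'⟩ := exists_norm_le_mul_trace hyp
  obtain ⟨d, hd, hd'⟩ := exists_one_le_smul hxp
  obtain ⟨K, hK⟩ := banach_steinhaus (ι := {p : MatrixEnd n × ℝ // p ∈ S ∧ |p.2| ≤ R})
    (g := fun p => p.1.1) (fun Z => by
      have hZ : Z ∈ Submodule.span ℂ {A : Matrix n n ℂ | 0 ≤ A} := by
        rw [CStarAlgebra.span_nonneg]; trivial
      induction hZ using Submodule.span_induction with
      | mem A hA =>
        have hA : 0 ≤ A := hA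
        refine ⟨‖A‖ * (d * (c * C)), fun p => ?_⟩
        have hF := h.isTwoPositive _ p.2.1
        have h1 : A ≤ ((‖A‖ : ℝ) : ℂ) • (d : ℂ) • x := by
          refine (le_norm_smul_one hA).trans ?_
          exact smul_le_smul_of_nonneg_left hd' (by exact_mod_cast norm_nonneg A)
        have h2 := hF.map_mono h1
        rw [map_smul, map_smul] at h2
        refine (CStarAlgebra.norm_le_norm_of_nonneg_of_le (hF.map_nonneg hA) h2).trans ?_
        rw [norm_smul, norm_smul, Complex.norm_real, Complex.norm_real, norm_norm,
          Real.norm_of_nonneg hd]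
        have h3 := hc' _ (hF.map_nonneg (nonneg_iff_posSemidef.2 hxp.posSemidef))
        have h4 := hC _ p.2.1 p.2.2
        gcongr
        exact h3.trans (by gcongr)
      | zero => exact ⟨0, fun p => by simp⟩
      | add A B _ _ hA hB =>
        obtain ⟨a, ha⟩ := hA
        obtain ⟨b, hb⟩ := hB
        exact ⟨a + b, fun p => by
          rw [map_add]; exact (norm_add_le _ _).trans (add_le_add (ha p) (hb p))⟩
      | smul z A _ hA =>
        obtain ⟨a, ha⟩ := hA
        exact ⟨‖z‖ * a, fun p => by
          rw [map_smul, norm_smul]; exact mul_le_mul_of_nonneg_left (ha p) (norm_nonneg z)⟩)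
  exact ⟨K, fun p hp hpR => hK ⟨p, hp, hpR⟩⟩

theorem closure (h : IsPositiveModel f S e X Y) (hf : Continuous f) :
    IsPositiveModel f (_root_.closure S) e X Y where
  isTwoPositive p hp := by
    have hc : IsClosed {p : MatrixEnd n × ℝ | IsTwoPositive p.1} :=
      isClosed_isTwoPositive.preimage continuous_fst
    exact closure_minimal (fun p hp => h.isTwoPositive p hp) hc hp
  mul_mem p hp q hq := by
    refine map_mem_closure₂ (f := fun p q : MatrixEnd n × ℝ => (p.1 * q.1, p.2 + q.2)) ?_ hp hq
      fun p hp q hq => h.mul_mem p hp q hq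
    fun_prop
  unit_mem := subset_closure h.unit_mem
  unit_mul p hp := by
    have hc : IsClosed {p : MatrixEnd n × ℝ | e * p.1 = p.1} :=
      isClosed_eq (by fun_prop) (by fun_prop)
    exact closure_minimal (fun p hp => h.unit_mul p hp) hc hp
  mul_unit p hp := by
    have hc : IsClosed {p : MatrixEnd n × ℝ | p.1 * e = p.1} :=
      isClosed_eq (by fun_prop) (by fun_prop)
    exact closure_minimal (fun p hp => h.mul_unit p hp) hc hp
  nonneg_left := h.nonneg_left
  nonneg_right := h.nonneg_right
  unit_left := h.unit_left
  unit_right := h.unit_right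
  trace_eq p hp := by
    have hc : IsClosed {p : MatrixEnd n × ℝ | trace (Y * p.1 X) = (f p.2 : ℂ)} :=
      isClosed_eq (by
        refine Continuous.matrix_trace ?_
        fun_prop) (by fun_prop)
    exact closure_minimal (fun p hp => h.trace_eq p hp) hc hp
  dense := h.dense.mono (Set.image_mono subset_closure)

/-- An idempotent of degree zero cuts out a smaller model: F ↦ e'Fe' preserves degrees, so they stay
dense. -/
theorem cut (h : IsPositiveModel f S e X Y) {e' : MatrixEnd n} (he : (e', 0) ∈ S)
    (hi : e' * e' = e') :
    IsPositiveModel f {p ∈ S | e' * p.1 = p.1 ∧ p.1 * e' = p.1} e' (e' X) (traceAdjoint e' Y) where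
  isTwoPositive p hp := h.isTwoPositive p hp.1
  mul_mem p hp q hq := ⟨h.mul_mem p hp.1 q hq.1, by rw [← mul_assoc, hp.2.1],
    by rw [mul_assoc, hq.2.2]⟩
  unit_mem := ⟨he, hi, hi⟩
  unit_mul p hp := hp.2.1
  mul_unit p hp := hp.2.2
  nonneg_left := (h.isTwoPositive _ he).map_nonneg h.nonneg_left
  nonneg_right := (h.isTwoPositive _ he).traceAdjoint.map_nonneg h.nonneg_right
  unit_left := congrArg (fun G : MatrixEnd n => G X) hi
  unit_right := by
    have := congrArg traceAdjoint hi
    rw [traceAdjoint_mul] at this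
    exact congrArg (fun G : MatrixEnd n => G Y) this
  trace_eq p hp := by
    rw [trace_traceAdjoint_mul, ← h.trace_eq p hp.1]
    have := congrArg (fun G : MatrixEnd n => G X) hp.2.2
    simp only [mul_apply_eq_comp] at this
    rw [this]
    have := congrArg (fun G : MatrixEnd n => G X) hp.2.1
    simp only [mul_apply_eq_comp] at this
    rw [this]
  dense := by
    refine h.dense.mono ?_
    rintro _ ⟨p, hp, rfl⟩
    refine ⟨(e' * (p.1 * e'), p.2), ⟨?_, ?_, ?_⟩, rfl⟩
    · simpa using h.mul_mem _ he _ (h.mul_mem _ hp _ he)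
    · simp only
      rw [← mul_assoc, hi]
    · simp only
      rw [mul_assoc, mul_assoc, hi]

end IsPositiveModel

end Minimal
end

noncomputable section

open scoped Matrix.Norms.L2Operator MatrixOrder ComplexOrder
open Matrix

/-! ### Compact semigroups and an invertible map of negative degree -/

section Inverse

set_option linter.unusedSectionVars false

variable {n m : Type*} [Fintype n] [DecidableEq n] [Fintype m] [DecidableEq m]

/-- The closure of the positive powers of F contains an idempotent by the Ellis–Numakura lemma, and
it can only be e. This closure lies in F times the compact closure of the powers from exponent zero
on, so e = F G. -/
theorem exists_inverse_of_unique_idempotent {K : Set (MatrixEnd n)} (hK : IsCompact K)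
    {e : MatrixEnd n} (he : e ∈ K) (hmul : ∀ F ∈ K, ∀ G ∈ K, F * G ∈ K)
    (hunit : ∀ F ∈ K, F * e = F) (hunit' : ∀ F ∈ K, e * F = F)
    (huniq : ∀ e' ∈ K, e' * e' = e' → e' = e) {F : MatrixEnd n} (hF : F ∈ K) :
    ∃ G ∈ K, F * G = e ∧ G * F = e := by
  -- The factor e makes the zeroth power equal to e; the identity map itself need not lie in K.
  have hpow : ∀ k : ℕ, F ^ k * e ∈ K := by
    intro k
    induction k with
    | zero => simpa using he
    | succ k ih => rw [pow_succ', mul_assoc]; exact hmul _ hF _ ih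
  set T := closure (Set.range fun k : ℕ => F ^ (k + 1)) with hT
  have hFe : ∀ k : ℕ, F * (F ^ k * e) = F ^ (k + 1) := fun k => by
    rw [← mul_assoc, ← pow_succ', pow_succ, mul_assoc, hunit F hF]
  have hTK : T ⊆ K := by
    refine closure_minimal ?_ hK.isClosed
    rintro _ ⟨k, rfl⟩
    simp only
    rw [← hFe]
    exact hmul _ hF _ (hpow k)
  have hTc : IsCompact T := hK.of_isClosed_subset isClosed_closure hTK
  have heT : e ∈ T := by
    obtain ⟨e', he', hi⟩ := exists_idempotent_in_compact_subsemigroup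
      (fun r : MatrixEnd n => by fun_prop) T ⟨F, subset_closure ⟨0, by simp⟩⟩ hTc
      (fun a ha b hb => map_mem_closure₂ (f := fun a b : MatrixEnd n => a * b) (by fun_prop) ha hb
        (by
          rintro _ ⟨k, rfl⟩ _ ⟨l, rfl⟩
          exact ⟨k + l + 1, by simp only; rw [← pow_add]; congr 1; ring⟩))
    rwa [← huniq e' (hTK he') hi]
  set P := closure (Set.range fun k : ℕ => F ^ k * e) with hP
  have hPK : P ⊆ K := by
    refine closure_minimal ?_ hK.isClosed
    rintro _ ⟨k, rfl⟩
    exact hpow k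
  have hPc : IsCompact P := hK.of_isClosed_subset isClosed_closure hPK
  have hcomm : ∀ G ∈ P, G * F = F * G := by
    intro G hG
    have hc : IsClosed {G : MatrixEnd n | G * F = F * G} := isClosed_eq (by fun_prop) (by fun_prop)
    refine closure_minimal ?_ hc hG
    rintro _ ⟨k, rfl⟩
    change F ^ k * e * F = F * (F ^ k * e)
    rw [hFe, mul_assoc, hunit' F hF, pow_succ]
  have himg : IsClosed ((fun G => F * G) '' P) :=
    (hPc.image (by fun_prop)).isClosed
  have : T ⊆ (fun G => F * G) '' P := by
    refine closure_minimal ?_ himg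
    rintro _ ⟨k, rfl⟩
    exact ⟨_, subset_closure ⟨k, rfl⟩, hFe k⟩
  obtain ⟨G, hG, hGe⟩ := this heT
  exact ⟨G, hPK hG, hGe, (hcomm G hG).trans hGe⟩

/-- The ranges are nested and of equal dimension, hence equal, and e' is the identity on its range.
-/
theorem eq_of_finrank_range_le {e e' : MatrixEnd n} (h1 : e * e' = e') (h2 : e' * e = e')
    (hi : e' * e' = e')
    (hr : Module.finrank ℂ (LinearMap.range e.toLinearMap) ≤
      Module.finrank ℂ (LinearMap.range e'.toLinearMap)) : e' = e := by
  have hle : LinearMap.range e'.toLinearMap ≤ LinearMap.range e.toLinearMap := by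
    rintro _ ⟨x, rfl⟩
    exact ⟨e' x, congrArg (fun G : MatrixEnd n => G x) h1⟩
  have heq := Submodule.eq_of_le_of_finrank_le hle hr
  ext1 x
  have hx : e x ∈ LinearMap.range e'.toLinearMap := by rw [heq]; exact ⟨x, rfl⟩
  obtain ⟨z, hz⟩ := hx
  have hz : e' z = e x := hz
  calc e' x = e' (e x) := (congrArg (fun G : MatrixEnd n => G x) h2).symm
    _ = e' (e' z) := by rw [hz]
    _ = e' z := congrArg (fun G : MatrixEnd n => G z) hi
    _ = e x := hz

/-- A 2-positive map `F` which is invertible in the corner of the idempotent `e`, with faithful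
`e`-invariant vectors, and whose powers realize the values `f (k θ)`. -/
structure IsInvertibleModel (f : ℝ → ℝ) (θ : ℝ) (e F F' : MatrixEnd n)
    (x y X Y : Matrix n n ℂ) : Prop where
  unit_isTwoPositive : IsTwoPositive e
  isTwoPositive : IsTwoPositive F
  inv_isTwoPositive : IsTwoPositive F'
  unit_mul_unit : e * e = e
  unit_mul : e * F = F
  mul_unit : F * e = F
  unit_mul_inv : e * F' = F'
  inv_mul_unit : F' * e = F'
  mul_inv : F * F' = e
  inv_mul : F' * F = e
  posDef_left : x.PosDef
  unit_posDef_left : e x = x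
  posDef_right : y.PosDef
  unit_posDef_right : traceAdjoint e y = y
  nonneg_left : 0 ≤ X
  unit_left : e X = X
  nonneg_right : 0 ≤ Y
  trace_eq : ∀ k : ℕ, trace (Y * (F ^ k) X) = (f (k * θ) : ℂ)

namespace IsPositiveModel

variable {f : ℝ → ℝ} {S : Set (MatrixEnd n × ℝ)} {e : MatrixEnd n} {X Y : Matrix n n ℂ}

theorem isCompact_closure_inter (h : IsPositiveModel f S e X Y) (hf : Continuous f)
    {x y : Matrix n n ℂ} (hx : x ∈ orbitSums S X) (hxp : x.PosDef)
    (hy : y ∈ orbitSums (adjointMaps S) Y) (hyp : y.PosDef) (a b : ℝ) :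
    IsCompact {p ∈ _root_.closure S | p.2 ∈ Set.Icc a b} := by
  have hcl := h.closure hf
  have hbd : ∀ R : ℝ, ∃ C : ℝ, ∀ p ∈ _root_.closure S, |p.2| ≤ R → ‖p.1‖ ≤ C := fun R =>
    hcl.exists_norm_bound hf (x := x) (y := y)
      (AddSubmonoid.closure_mono (Set.image_mono subset_closure) hx) hxp
      (AddSubmonoid.closure_mono (Set.image_mono (Set.image_mono subset_closure)) hy) hyp R
  have : ProperSpace (MatrixEnd n) := FiniteDimensional.proper ℂ (MatrixEnd n)
  refine Metric.isCompact_of_isClosed_isBounded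
    (isClosed_closure.inter (isClosed_Icc.preimage continuous_snd)) ?_
  obtain ⟨C, hC⟩ := hbd (max |a| |b|)
  refine (Metric.isBounded_closedBall (x := (0 : MatrixEnd n × ℝ))
    (r := max C (max |a| |b|))).subset fun p hp => ?_
  have h2 : |p.2| ≤ max |a| |b| := by
    have := abs_le_max_abs_abs hp.2.1 hp.2.2
    exact this
  rw [mem_closedBall_zero_iff]
  exact max_le_max (hC p hp.1 h2) h2

theorem isCompact_degree_zero (h : ∀ a b : ℝ, IsCompact {p ∈ S | p.2 ∈ Set.Icc a b}) :
    IsCompact {F : MatrixEnd n | (F, (0 : ℝ)) ∈ S} := by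
  have : {F : MatrixEnd n | (F, (0 : ℝ)) ∈ S} =
      Prod.fst '' {p ∈ S | p.2 ∈ Set.Icc (0 : ℝ) 0} := by
    ext F
    constructor
    · intro hF
      exact ⟨(F, 0), ⟨hF, by simp⟩, rfl⟩
    · rintro ⟨⟨G, t⟩, ⟨hG, ht⟩, rfl⟩
      have : t = 0 := by simpa using ht
      subst this
      exact hG
  rw [this]
  exact (h 0 0).image continuous_fst

/-- The degree-zero part K of the closure is a compact group, and every degree needed is attained in
the closure. If F and F₂ have opposite degrees, F F₂ and F₂ F lie in K, so F is invertible relative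
to e. -/
theorem exists_isInvertibleModel_of_minimal (h : IsPositiveModel f S e X Y) (hf : Continuous f)
    (hmin : ∀ (s : Set n) (_ : DecidablePred (· ∈ s)) (T : Set (MatrixEnd s × ℝ))
      (e' : MatrixEnd s) (X' Y' : Matrix s s ℂ), IsPositiveModel f T e' X' Y' →
      Fintype.card n ≤ Fintype.card s)
    (hrank : ∀ (T : Set (MatrixEnd n × ℝ)) (e' : MatrixEnd n) (X' Y' : Matrix n n ℂ),
      IsPositiveModel f T e' X' Y' → Module.finrank ℂ (LinearMap.range e.toLinearMap) ≤
        Module.finrank ℂ (LinearMap.range e'.toLinearMap)) :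
    ∃ (θ : ℝ) (F F' : MatrixEnd n) (x y : Matrix n n ℂ), θ < 0 ∧
      IsInvertibleModel f θ e F F' x y X Y := by
  obtain ⟨x, hx, hxp⟩ := h.exists_posDef hmin
  obtain ⟨y, hy, hyp⟩ := h.adjoint.exists_posDef hmin
  have hcl := h.closure hf
  have hcomp := h.isCompact_closure_inter hf hx hxp hy hyp
  set K : Set (MatrixEnd n) := {F | (F, (0 : ℝ)) ∈ _root_.closure S} with hK
  have hKc : IsCompact K := isCompact_degree_zero hcomp
  have hKmul : ∀ F ∈ K, ∀ G ∈ K, F * G ∈ K := fun F hF G hG => by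
    simpa [hK] using hcl.mul_mem _ hF _ hG
  -- An idempotent other than e would cut out a model whose unit has smaller rank.
  have hinv : ∀ F ∈ K, ∃ G ∈ K, F * G = e ∧ G * F = e := fun F hF =>
    exists_inverse_of_unique_idempotent hKc hcl.unit_mem hKmul (fun F hF => hcl.mul_unit _ hF)
      (fun F hF => hcl.unit_mul _ hF)
      (fun e' he' hi => eq_of_finrank_range_le (hcl.unit_mul _ he') (hcl.mul_unit _ he') hi
        (hrank _ _ _ _ (hcl.cut he' hi))) hF
  obtain ⟨_, ⟨⟨F, θ⟩, hF, rfl⟩, hθ⟩ := h.dense.exists_mem_open (isOpen_Iio (a := (0 : ℝ)))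
    ⟨-1, by simp⟩
  have hθ : θ < 0 := hθ
  have hF : (F, θ) ∈ _root_.closure S := subset_closure hF
  -- Degrees accumulate at -θ, and the part of the closure with degrees in a compact interval is
  -- compact, so its degrees form a closed set.
  have hsurj : -θ ∈ Prod.snd '' {p ∈ _root_.closure S | p.2 ∈ Set.Icc (-θ - 1) (-θ + 1)} := by
    have hclosed := ((hcomp (-θ - 1) (-θ + 1)).image continuous_snd).isClosed
    refine hclosed.closure_subset_iff.2 le_rfl (Metric.mem_closure_iff.2 fun ε hε => ?_)
    obtain ⟨_, hpd, ⟨p, hp, rfl⟩⟩ := Metric.dense_iff.1 h.dense (-θ) (min ε 1) (by positivity)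
    rw [Metric.mem_ball, dist_comm] at hpd
    refine ⟨p.2, ⟨p, ⟨subset_closure hp, ?_⟩, rfl⟩, hpd.trans_le (min_le_left _ _)⟩
    have := abs_lt.1 (hpd.trans_le (min_le_right _ _))
    constructor <;> linarith [this.1, this.2]
  obtain ⟨⟨F₂, _⟩, ⟨hF₂, -⟩, rfl⟩ := hsurj
  have hF₂ : (F₂, -θ) ∈ _root_.closure S := hF₂
  obtain ⟨G, hG, hG1, -⟩ := hinv (F * F₂) (by simpa [hK] using hcl.mul_mem _ hF _ hF₂)
  obtain ⟨G', hG', -, hG2⟩ := hinv (F₂ * F) (by simpa [hK] using hcl.mul_mem _ hF₂ _ hF)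
  have hmem : (F₂ * G, -θ) ∈ _root_.closure S := by simpa using hcl.mul_mem _ hF₂ _ hG
  have hr : F * (F₂ * G) = e := by rw [← mul_assoc, hG1]
  have hl : F₂ * G * F = e := by
    have h1 : G' * F₂ = F₂ * G := by
      calc G' * F₂ = G' * (F₂ * e) := by rw [hcl.mul_unit _ hF₂]
        _ = G' * (F₂ * F) * (F₂ * G) := by rw [← hr]; simp only [mul_assoc]
        _ = F₂ * G := by rw [hG2, hcl.unit_mul _ hmem]
    rw [← h1, mul_assoc, hG2]
  have hpow : ∀ k : ℕ, (F ^ k * e, k * θ) ∈ _root_.closure S := by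
    intro k
    induction k with
    | zero => simpa using hcl.unit_mem
    | succ k ih =>
      have := hcl.mul_mem _ hF _ ih
      rw [pow_succ', mul_assoc]
      convert this using 2
      push_cast; ring
  have htr0 : ∀ k : ℕ, trace (Y * (F ^ k * e) X) = (f (k * θ) : ℂ) := fun k =>
    hcl.trace_eq (F ^ k * e, k * θ) (hpow k)
  have htr1 : ∀ k : ℕ, (F ^ k * e) X = (F ^ k) (e X) := fun k => mul_apply_eq_comp _ _ _
  have htr : ∀ k : ℕ, trace (Y * (F ^ k) X) = (f (k * θ) : ℂ) := fun k => by
    rw [← htr0, htr1, h.unit_left]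
  exact ⟨θ, F, F₂ * G, x, y, hθ,
    { unit_isTwoPositive := h.isTwoPositive (e, 0) h.unit_mem
      isTwoPositive := hcl.isTwoPositive (F, θ) hF
      inv_isTwoPositive := hcl.isTwoPositive (F₂ * G, -θ) hmem
      unit_mul_unit := h.unit_mul (e, 0) h.unit_mem
      unit_mul := hcl.unit_mul (F, θ) hF
      mul_unit := hcl.mul_unit (F, θ) hF
      unit_mul_inv := hcl.unit_mul (F₂ * G, -θ) hmem
      inv_mul_unit := hcl.mul_unit (F₂ * G, -θ) hmem
      mul_inv := hr
      inv_mul := hl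
      posDef_left := hxp
      unit_posDef_left := h.unit_orbitSums hx
      posDef_right := hyp
      unit_posDef_right := h.adjoint.unit_orbitSums hy
      nonneg_left := h.nonneg_left
      unit_left := h.unit_left
      nonneg_right := h.nonneg_right
      trace_eq := htr }⟩

end IsPositiveModel

/-- Lexicographic minimization: first the size of the matrices, then, at that size, the rank of the
unit. -/
theorem exists_isInvertibleModel {f : ℝ → ℝ} (hf : Continuous f) {n : Type} [Fintype n]
    [DecidableEq n] {S : Set (MatrixEnd n × ℝ)} {e : MatrixEnd n} {X Y : Matrix n n ℂ}
    (h : IsPositiveModel f S e X Y) :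
    ∃ (n : Type) (_ : Fintype n) (_ : DecidableEq n) (θ : ℝ) (e F F' : MatrixEnd n)
      (x y X Y : Matrix n n ℂ), θ < 0 ∧ IsInvertibleModel f θ e F F' x y X Y := by
  classical
  let P : ℕ → Prop := fun k => ∃ (n : Type) (_ : Fintype n) (_ : DecidableEq n),
    Fintype.card n = k ∧ ∃ (S : Set (MatrixEnd n × ℝ)) (e : MatrixEnd n) (X Y : Matrix n n ℂ),
      IsPositiveModel f S e X Y
  have hP : ∃ k, P k := ⟨_, n, _, _, rfl, S, e, X, Y, h⟩
  obtain ⟨n, i₁, i₂, hcard, hmodel⟩ := Nat.find_spec hP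
  have hmin : ∀ (s : Set n) (_ : DecidablePred (· ∈ s)) (T : Set (MatrixEnd s × ℝ))
      (e' : MatrixEnd s) (X' Y' : Matrix s s ℂ), IsPositiveModel f T e' X' Y' →
      Fintype.card n ≤ Fintype.card s := fun s _ T e' X' Y' h' => by
    rw [hcard]
    exact Nat.find_min' hP ⟨s, _, _, rfl, T, e', X', Y', h'⟩
  let Q : ℕ → Prop := fun r => ∃ (S : Set (MatrixEnd n × ℝ)) (e : MatrixEnd n)
    (X Y : Matrix n n ℂ), IsPositiveModel f S e X Y ∧
      Module.finrank ℂ (LinearMap.range e.toLinearMap) = r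
  have hQ : ∃ r, Q r := by
    obtain ⟨S, e, X, Y, h⟩ := hmodel
    exact ⟨_, S, e, X, Y, h, rfl⟩
  obtain ⟨S, e, X, Y, h, hr⟩ := Nat.find_spec hQ
  obtain ⟨θ, F, F', x, y, hθ, hI⟩ := h.exists_isInvertibleModel_of_minimal hf hmin
    fun T e' X' Y' h' => by
      rw [hr]
      exact Nat.find_min' hQ ⟨T, e', X', Y', h', rfl⟩
  exact ⟨n, i₁, i₂, θ, e, F, F', x, y, X, Y, hθ, hI⟩

end Inverse
end

noncomputable section

/-! ### Iterates of a linear map do not grow like a square root -/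

section Growth

theorem not_forall_mul_le_sqrt {c : ℝ} (hc : 0 < c) (a b : ℝ) (j : ℕ) :
    ¬ ∀ k : ℕ, c * k ≤ a * √(j + k + 1) + b := by
  intro h
  set d := |a| + 1 with hd
  have hd0 : 0 < d := by positivity
  obtain ⟨k, hk⟩ := exists_nat_gt ((j + 1 + 2 * (b / c) + (d / c) ^ 2))
  have h1 := h k
  have h2 : a * √(j + k + 1) ≤ d * √(j + k + 1) :=
    mul_le_mul_of_nonneg_right (by linarith [le_abs_self a]) (Real.sqrt_nonneg _)
  -- AM-GM, weighted so that half of the linear term on the left absorbs the square root.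
  have h3 : d * √(j + k + 1) ≤ c / 2 * (j + k + 1) + d ^ 2 / (2 * c) := by
    have hs : √((j : ℝ) + k + 1) ^ 2 = j + k + 1 := Real.sq_sqrt (by positivity)
    have : 0 ≤ (c * √((j : ℝ) + k + 1) - d) ^ 2 / (2 * c) := by positivity
    have e : (c * √((j : ℝ) + k + 1) - d) ^ 2 / (2 * c) =
        c / 2 * √((j : ℝ) + k + 1) ^ 2 + d ^ 2 / (2 * c) - d * √(j + k + 1) := by
      field_simp; ring
    rw [e, hs] at this
    linarith
  have h4 : c * ((j + 1 + 2 * (b / c) + (d / c) ^ 2)) < c * k := mul_lt_mul_of_pos_left hk hc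
  have h5 : c * ((j + 1 + 2 * (b / c) + (d / c) ^ 2)) = c * (j + 1) + 2 * b + d ^ 2 / c := by
    field_simp
  have h6 : d ^ 2 / c = 2 * (d ^ 2 / (2 * c)) := by field_simp
  rw [h5, h6] at h4
  linarith

variable {V W : Type*} [AddCommGroup V] [Module ℂ V] [NormedAddCommGroup W] [NormedSpace ℂ W]

/-- If |μ| < 1 the orbit is bounded by a geometric argument. If |μ| ≥ 1, a Jordan block visible
through Φ would force at least linear growth, so Φ sees the pure orbit μ^k Φ v; for |μ| > 1
Bernoulli's inequality then forces Φ v = 0. -/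
theorem bounded_iterate_of_sqrt_growth_of_genEigen {R : Module.End ℂ V} (Φ : V →ₗ[ℂ] W)
    (hgrow : ∀ v, ∃ C : ℝ, ∀ k : ℕ, ‖Φ ((R ^ k) v)‖ ≤ C * √(k + 1)) (μ : ℂ) (N : ℕ) (v : V)
    (hv : ((R - algebraMap ℂ _ μ) ^ N) v = 0) : ∃ C : ℝ, ∀ k : ℕ, ‖Φ ((R ^ k) v)‖ ≤ C := by
  have hstep : ∀ (v : V) (k : ℕ),
      Φ ((R ^ (k + 1)) v) = μ • Φ ((R ^ k) v) + Φ ((R ^ k) ((R - algebraMap ℂ _ μ) v)) := by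
    intro v k
    rw [← map_smul, ← map_add, ← map_smul, ← map_add, pow_succ]
    simp
  rcases lt_or_ge ‖μ‖ 1 with hμ | hμ
  · induction N generalizing v with
    | zero => exact ⟨0, fun k => by simp [show v = 0 by simpa using hv]⟩
    | succ N ih =>
      obtain ⟨C, hC⟩ := ih ((R - algebraMap ℂ _ μ) v) (by rw [pow_succ] at hv; exact hv)
      have h1 : 0 < 1 - ‖μ‖ := by linarith
      refine ⟨max ‖Φ v‖ (C / (1 - ‖μ‖)), fun k => ?_⟩
      induction k with
      | zero => simp
      | succ k ihk =>
        rw [hstep]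
        refine (norm_add_le _ _).trans ?_
        rw [norm_smul]
        set M := max ‖Φ v‖ (C / (1 - ‖μ‖))
        have h2 : C ≤ M * (1 - ‖μ‖) := (div_le_iff₀ h1).1 (le_max_right _ _)
        have h3 := mul_le_mul_of_nonneg_left ihk (norm_nonneg μ)
        linarith [hC k]
  · have hnull : ∀ j, Φ ((R ^ j) ((R - algebraMap ℂ _ μ) v)) = 0 := by
      induction N generalizing v with
      | zero => intro j; simp [show v = 0 by simpa using hv]
      | succ N ih =>
        set w := (R - algebraMap ℂ _ μ) v with hw
        have hw0 := ih w (by rw [pow_succ] at hv; exact hv)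
        intro j
        have e1 : ∀ k : ℕ, Φ ((R ^ (j + k)) w) = μ ^ k • Φ ((R ^ j) w) := by
          intro k
          induction k with
          | zero => simp
          | succ k ihk => rw [← add_assoc, hstep, hw0, ihk, add_zero, smul_smul, pow_succ']
        -- The extra factor μ avoids the exponent k - 1 in the Jordan block formula.
        have e2 : ∀ k : ℕ, μ • Φ ((R ^ (j + k)) v) =
            μ ^ k • (μ • Φ ((R ^ j) v) + (k : ℂ) • Φ ((R ^ j) w)) := by
          intro k
          induction k with
          | zero => simp
          | succ k ihk =>
            rw [← add_assoc, hstep, ihk, ← hw, e1]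
            push_cast
            module
        by_contra hne
        have hc : 0 < ‖Φ ((R ^ j) w)‖ := norm_pos_iff.2 hne
        obtain ⟨C, hC⟩ := hgrow v
        refine not_forall_mul_le_sqrt hc (‖μ‖ * C) (‖μ‖ * ‖Φ ((R ^ j) v)‖) j fun k => ?_
        have h1 : ‖μ • Φ ((R ^ (j + k)) v)‖ ≤ ‖μ‖ * (C * √(j + k + 1)) := by
          rw [norm_smul]
          have := hC (j + k)
          push_cast at this
          exact mul_le_mul_of_nonneg_left this (norm_nonneg μ)
        have h2 : ‖(k : ℂ) • Φ ((R ^ j) w)‖ - ‖μ • Φ ((R ^ j) v)‖ ≤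
            ‖μ • Φ ((R ^ (j + k)) v)‖ := by
          rw [e2, norm_smul (μ ^ k), norm_pow]
          have h3 : 1 ≤ ‖μ‖ ^ k := one_le_pow₀ hμ
          have h4 := norm_sub_le (μ • Φ ((R ^ j) v) + (k : ℂ) • Φ ((R ^ j) w)) (μ • Φ ((R ^ j) v))
          rw [add_sub_cancel_left] at h4
          have h5 := le_mul_of_one_le_left
            (norm_nonneg (μ • Φ ((R ^ j) v) + (k : ℂ) • Φ ((R ^ j) w))) h3
          linarith
        rw [norm_smul, norm_smul, Complex.norm_natCast] at h2
        linarith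
    have e1 : ∀ k : ℕ, Φ ((R ^ k) v) = μ ^ k • Φ v := by
      intro k
      induction k with
      | zero => simp
      | succ k ihk => rw [hstep, hnull, ihk, add_zero, smul_smul, pow_succ']
    rcases hμ.eq_or_lt with hμ | hμ
    · exact ⟨‖Φ v‖, fun k => by rw [e1, norm_smul, norm_pow, ← hμ]; simp⟩
    · suffices Φ v = 0 from ⟨0, fun k => by rw [e1, this]; simp⟩
      by_contra hne
      have hc : 0 < ‖Φ v‖ := norm_pos_iff.2 hne
      obtain ⟨C, hC⟩ := hgrow v
      refine not_forall_mul_le_sqrt (mul_pos hc (sub_pos.2 hμ)) C 0 0 fun k => ?_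
      have h1 := hC k
      rw [e1, norm_smul, norm_pow] at h1
      have h2 := one_add_mul_le_pow (a := ‖μ‖ - 1) (by linarith) k
      rw [add_sub_cancel] at h2
      have h3 := mul_le_mul_of_nonneg_right h2 hc.le
      have h4 : (1 + k * (‖μ‖ - 1)) * ‖Φ v‖ = ‖Φ v‖ + ‖Φ v‖ * (‖μ‖ - 1) * k := by ring
      push_cast
      rw [zero_add, add_zero]
      linarith

/-- The norms of the iterates of a linear map on a finite-dimensional space cannot grow like the
square root. -/
theorem bounded_iterate_of_sqrt_growth [FiniteDimensional ℂ V] {R : Module.End ℂ V}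
    (Φ : V →ₗ[ℂ] W) {v : V} {C : ℝ} (hgrow : ∀ k : ℕ, ‖Φ ((R ^ k) v)‖ ≤ C * √(k + 1)) :
    ∃ C : ℝ, ∀ k : ℕ, ‖Φ ((R ^ k) v)‖ ≤ C := by
  -- The result for generalized eigenvectors needs the growth bound on the whole space, so R is
  -- restricted to the invariant subspace of vectors that obey one.
  let B : Submodule ℂ V :=
    { carrier := {v | ∃ C : ℝ, ∀ k : ℕ, ‖Φ ((R ^ k) v)‖ ≤ C * √(k + 1)}
      add_mem' := by
        rintro a b ⟨C, hC⟩ ⟨D, hD⟩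
        refine ⟨C + D, fun k => ?_⟩
        rw [map_add, map_add, add_mul]
        exact (norm_add_le _ _).trans (add_le_add (hC k) (hD k))
      zero_mem' := ⟨0, fun k => by simp⟩
      smul_mem' := by
        rintro c a ⟨C, hC⟩
        refine ⟨‖c‖ * C, fun k => ?_⟩
        rw [map_smul, map_smul, norm_smul, mul_assoc]
        exact mul_le_mul_of_nonneg_left (hC k) (norm_nonneg c) }
  have hR : ∀ x ∈ B, R x ∈ B := by
    rintro x ⟨C, hC⟩
    refine ⟨|C| * √2, fun k => ?_⟩
    have h1 := hC (k + 1)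
    rw [pow_succ] at h1
    refine h1.trans ?_
    rw [mul_assoc, ← Real.sqrt_mul (by norm_num)]
    have h2 : √(((k + 1 : ℕ) : ℝ) + 1) ≤ √(2 * (k + 1)) :=
      Real.sqrt_le_sqrt (by push_cast; linarith [(Nat.cast_nonneg k : (0 : ℝ) ≤ k)])
    exact mul_le_mul (le_abs_self C) h2 (Real.sqrt_nonneg _) (abs_nonneg C)
  let Q : Module.End ℂ B := R.restrict hR
  have hQ : ∀ (k : ℕ) (x : B), (((Q ^ k) x : B) : V) = (R ^ k) (x : V) := by
    intro k x
    induction k generalizing x with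
    | zero => simp
    | succ k ih => rw [pow_succ, pow_succ]; exact ih (Q x)
  have key : ∀ x : B, ∃ C : ℝ, ∀ k : ℕ, ‖(Φ ∘ₗ B.subtype) ((Q ^ k) x)‖ ≤ C := by
    have hg : ∀ x : B, ∃ C : ℝ, ∀ k : ℕ, ‖(Φ ∘ₗ B.subtype) ((Q ^ k) x)‖ ≤ C * √(k + 1) := by
      rintro ⟨x, C, hC⟩
      refine ⟨C, fun k => ?_⟩
      rw [LinearMap.comp_apply, Submodule.subtype_apply, hQ]
      exact hC k
    let D : Submodule ℂ B :=
      { carrier := {x | ∃ C : ℝ, ∀ k : ℕ, ‖(Φ ∘ₗ B.subtype) ((Q ^ k) x)‖ ≤ C}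
        add_mem' := by
          rintro a b ⟨C, hC⟩ ⟨D, hD⟩
          refine ⟨C + D, fun k => ?_⟩
          rw [map_add, map_add]
          exact (norm_add_le _ _).trans (add_le_add (hC k) (hD k))
        zero_mem' := ⟨0, fun k => by simp⟩
        smul_mem' := by
          rintro c a ⟨C, hC⟩
          refine ⟨‖c‖ * C, fun k => ?_⟩
          rw [map_smul, map_smul, norm_smul]
          exact mul_le_mul_of_nonneg_left (hC k) (norm_nonneg c) }
    -- Vectors with bounded orbits form a subspace, and over ℂ the generalized eigenspaces span.
    have hD : (⊤ : Submodule ℂ B) ≤ D := by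
      rw [← Module.End.iSup_maxGenEigenspace_eq_top Q]
      refine iSup_le fun μ x hx => ?_
      obtain ⟨N, hN⟩ := (Module.End.mem_maxGenEigenspace Q μ x).1 hx
      refine bounded_iterate_of_sqrt_growth_of_genEigen _ hg μ N x ?_
      rwa [Algebra.algebraMap_eq_smul_one]
    exact fun x => hD trivial
  obtain ⟨M, hM⟩ := key ⟨v, C, hgrow⟩
  refine ⟨M, fun k => ?_⟩
  have := hM k
  rwa [LinearMap.comp_apply, Submodule.subtype_apply, hQ] at this

end Growth
end

noncomputable section

open scoped Matrix.Norms.L2Operator MatrixOrder ComplexOrder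
open Matrix

/-! ### The fixed-point algebra and a linear square root of the dynamics -/

section Root

set_option linter.unusedSectionVars false

variable {n : Type*} [Fintype n] [DecidableEq n]

theorem transportEnd_mul {U V : Matrix n n ℂ} (h : V * U = 1) (F G : MatrixEnd n) :
    transportEnd U V F * transportEnd U V G = transportEnd U V (F * G) := by
  have h' : Uᴴ * Vᴴ = 1 := by rw [← conjTranspose_mul, h, conjTranspose_one]
  ext1 A
  rw [mul_apply_eq_comp, transportEnd_apply, transportEnd_apply, transportEnd_apply,
    mul_apply_eq_comp]
  congr 3
  calc V * (U * G (V * A * Vᴴ) * Uᴴ) * Vᴴ = V * U * G (V * A * Vᴴ) * (Uᴴ * Vᴴ) := by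
        simp only [Matrix.mul_assoc]
    _ = G (V * A * Vᴴ) := by rw [h, h', Matrix.one_mul, Matrix.mul_one]

theorem traceAdjoint_transportEnd (U V : Matrix n n ℂ) (F : MatrixEnd n) :
    traceAdjoint (transportEnd U V F) = transportEnd Vᴴ Uᴴ (traceAdjoint F) := by
  ext1 A
  refine eq_of_trace_mul_eq fun C => ?_
  rw [trace_traceAdjoint_mul, transportEnd_apply, transportEnd_apply, conjTranspose_conjTranspose,
    conjTranspose_conjTranspose]
  have h1 : trace (A * (U * F (V * C * Vᴴ) * Uᴴ)) = trace (Uᴴ * A * U * F (V * C * Vᴴ)) := by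
    rw [← Matrix.mul_assoc, trace_mul_comm]
    simp only [Matrix.mul_assoc]
  have h2 : trace (Vᴴ * traceAdjoint F (Uᴴ * A * U) * V * C) =
      trace (traceAdjoint F (Uᴴ * A * U) * (V * C * Vᴴ)) := by
    rw [Matrix.mul_assoc, Matrix.mul_assoc, trace_mul_comm]
    simp only [Matrix.mul_assoc]
  rw [h1, h2, trace_traceAdjoint_mul]

namespace IsInvertibleModel

variable {f : ℝ → ℝ} {θ : ℝ} {e F F' : MatrixEnd n} {x y X Y : Matrix n n ℂ}

theorem transport (h : IsInvertibleModel f θ e F F' x y X Y) {U V : Matrix n n ℂ}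
    (hVU : V * U = 1) :
    IsInvertibleModel f θ (transportEnd U V e) (transportEnd U V F) (transportEnd U V F')
      (U * x * Uᴴ) (Vᴴ * y * V) (U * X * Uᴴ) (Vᴴ * Y * V) := by
  have hUV : U * V = 1 := mul_eq_one_comm.1 hVU
  have hUV' : Vᴴ * Uᴴ = 1 := by rw [← conjTranspose_mul, hUV, conjTranspose_one]
  have hVU' : Uᴴ * Vᴴ = 1 := by rw [← conjTranspose_mul, hVU, conjTranspose_one]
  have hcancel : ∀ Z : Matrix n n ℂ, V * (U * Z * Uᴴ) * Vᴴ = Z := fun Z => by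
    calc V * (U * Z * Uᴴ) * Vᴴ = V * U * Z * (Uᴴ * Vᴴ) := by simp only [Matrix.mul_assoc]
      _ = Z := by rw [hVU, hVU', Matrix.one_mul, Matrix.mul_one]
  have hcancel' : ∀ Z : Matrix n n ℂ, Uᴴ * (Vᴴ * Z * V) * U = Z := fun Z => by
    calc Uᴴ * (Vᴴ * Z * V) * U = Uᴴ * Vᴴ * Z * (V * U) := by simp only [Matrix.mul_assoc]
      _ = Z := by rw [hVU, hVU', Matrix.one_mul, Matrix.mul_one]
  have hU : IsUnit U := IsUnit.of_mul_eq_one V hUV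
  have hV : IsUnit V := IsUnit.of_mul_eq_one U hVU
  have hpow : ∀ k : ℕ, ((transportEnd U V F) ^ k) (U * X * Uᴴ) = U * (F ^ k) X * Uᴴ := by
    intro k
    induction k with
    | zero => rfl
    | succ k ih =>
      rw [pow_succ', mul_apply_eq_comp, ih, transportEnd_apply, hcancel, pow_succ',
        mul_apply_eq_comp]
  exact
    { unit_isTwoPositive := h.unit_isTwoPositive.transport U V
      isTwoPositive := h.isTwoPositive.transport U V
      inv_isTwoPositive := h.inv_isTwoPositive.transport U V
      unit_mul_unit := by rw [transportEnd_mul hVU, h.unit_mul_unit]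
      unit_mul := by rw [transportEnd_mul hVU, h.unit_mul]
      mul_unit := by rw [transportEnd_mul hVU, h.mul_unit]
      unit_mul_inv := by rw [transportEnd_mul hVU, h.unit_mul_inv]
      inv_mul_unit := by rw [transportEnd_mul hVU, h.inv_mul_unit]
      mul_inv := by rw [transportEnd_mul hVU, h.mul_inv]
      inv_mul := by rw [transportEnd_mul hVU, h.inv_mul]
      posDef_left := (IsUnit.posDef_star_right_conjugate_iff hU).2 h.posDef_left
      unit_posDef_left := by rw [transportEnd_apply, hcancel, h.unit_posDef_left]
      posDef_right := (IsUnit.posDef_star_left_conjugate_iff hV).2 h.posDef_right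
      unit_posDef_right := by
        rw [traceAdjoint_transportEnd, transportEnd_apply, conjTranspose_conjTranspose,
          conjTranspose_conjTranspose, hcancel', h.unit_posDef_right]
      nonneg_left := conj_nonneg U h.nonneg_left
      unit_left := by rw [transportEnd_apply, hcancel, h.unit_left]
      nonneg_right := by simpa using conj_nonneg Vᴴ h.nonneg_right
      trace_eq := fun k => by
        rw [hpow, ← h.trace_eq k, Matrix.mul_assoc, Matrix.mul_assoc, trace_mul_comm]
        conv_rhs => rw [← hcancel ((F ^ k) X)]
        simp only [Matrix.mul_assoc] }

/-- Write x = CᴴC and conjugate by C: the invariant vector x becomes 1, which makes the idempotent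
unital. -/
theorem exists_normalized (h : IsInvertibleModel f θ e F F' x y X Y) :
    ∃ (e F F' : MatrixEnd n) (y X Y : Matrix n n ℂ), IsInvertibleModel f θ e F F' 1 y X Y := by
  obtain ⟨C, hC⟩ :=
    CStarAlgebra.nonneg_iff_eq_star_mul_self.1 (nonneg_iff_posSemidef.2 h.posDef_left.posSemidef)
  rw [star_eq_conjTranspose] at hC
  have hu : IsUnit C.det := by
    have := (isUnit_iff_isUnit_det x).1 h.posDef_left.isUnit
    rw [hC, det_mul] at this
    exact (IsUnit.mul_iff.1 this).2
  have h1 : C * C⁻¹ = 1 := mul_nonsing_inv _ hu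
  have h2 : (C⁻¹)ᴴ * Cᴴ = 1 := by rw [← conjTranspose_mul, h1, conjTranspose_one]
  have h3 := h.transport (U := (C⁻¹)ᴴ) (V := Cᴴ) (mul_eq_one_comm.1 h2)
  have h4 : (C⁻¹)ᴴ * x * (C⁻¹)ᴴᴴ = 1 := by
    rw [hC, conjTranspose_conjTranspose, ← Matrix.mul_assoc, h2, Matrix.one_mul, h1]
  rw [h4] at h3
  exact ⟨_, _, _, _, _, _, h3⟩

theorem trace_unit (h : IsInvertibleModel f θ e F F' x y X Y) (Z : Matrix n n ℂ) :
    trace (y * e Z) = trace (y * Z) := by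
  rw [← trace_traceAdjoint_mul, h.unit_posDef_right]

theorem eq_zero_of_trace (h : IsInvertibleModel f θ e F F' x y X Y) {Z : Matrix n n ℂ}
    (hZ : 0 ≤ Z) (hy : trace (y * Z) = 0) : Z = 0 := by
  obtain ⟨c, -, hc⟩ := exists_norm_le_mul_trace h.posDef_right
  have := hc Z hZ
  rw [hy, norm_zero, mul_zero] at this
  exact norm_le_zero_iff.1 this

theorem eq_zero_of_unit_eq_zero (h : IsInvertibleModel f θ e F F' x y X Y) {Z : Matrix n n ℂ}
    (hZ : 0 ≤ Z) (he : e Z = 0) : Z = 0 :=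
  h.eq_zero_of_trace hZ (by rw [← h.trace_unit, he, Matrix.mul_zero, trace_zero])

/-- The Schwarz defect e(AᴴA) - AᴴA is positive and is annihilated by the faithful e-invariant
functional y. -/
theorem unit_conjTranspose_mul_self (h : IsInvertibleModel f θ e F F' 1 y X Y) {A : Matrix n n ℂ}
    (hA : e A = A) : e (Aᴴ * A) = Aᴴ * A := by
  have h1 := h.unit_isTwoPositive.schwarz h.unit_posDef_left A
  rw [hA] at h1
  rw [← sub_eq_zero]
  exact h.eq_zero_of_trace (sub_nonneg.2 h1)
    (by rw [Matrix.mul_sub, trace_sub, h.trace_unit, sub_self])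

theorem unit_conjTranspose (h : IsInvertibleModel f θ e F F' x y X Y) {A : Matrix n n ℂ}
    (hA : e A = A) : e Aᴴ = Aᴴ := by
  rw [h.unit_isTwoPositive.map_conjTranspose, hA]

/-- Polarization of the previous identity; the phases 1 and i suffice. -/
theorem unit_conjTranspose_mul (h : IsInvertibleModel f θ e F F' 1 y X Y) {A B : Matrix n n ℂ}
    (hA : e A = A) (hB : e B = B) : e (Aᴴ * B) = Aᴴ * B := by
  have hq : ∀ z : ℂ, z = 1 ∨ z = Complex.I →
      e (z • (Aᴴ * B) + star z • (Bᴴ * A)) = z • (Aᴴ * B) + star z • (Bᴴ * A) := by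
    intro z hz
    have hs : e (A + z • B) = A + z • B := by rw [map_add, map_smul, hA, hB]
    have hzz : z * star z = 1 := by rcases hz with rfl | rfl <;> simp
    have e1 : z • (Aᴴ * B) + star z • (Bᴴ * A) =
        (A + z • B)ᴴ * (A + z • B) - Aᴴ * A - Bᴴ * B := by
      rw [conjTranspose_add, conjTranspose_smul]
      simp only [Matrix.add_mul, Matrix.mul_add, Matrix.smul_mul, Matrix.mul_smul, smul_add,
        smul_smul, hzz, one_smul]
      abel
    rw [e1, map_sub, map_sub, h.unit_conjTranspose_mul_self hs, h.unit_conjTranspose_mul_self hA,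
      h.unit_conjTranspose_mul_self hB]
  have h1 := hq 1 (Or.inl rfl)
  have h2 := hq Complex.I (Or.inr rfl)
  have e2 : Aᴴ * B = (2⁻¹ : ℂ) • (((1 : ℂ) • (Aᴴ * B) + star (1 : ℂ) • (Bᴴ * A)) -
      Complex.I • (Complex.I • (Aᴴ * B) + star Complex.I • (Bᴴ * A))) := by
    simp only [smul_add, smul_smul, star_one, one_smul, Complex.star_def, Complex.conj_I,
      Complex.I_mul_I, neg_neg, neg_smul, smul_sub, smul_neg]
    module
  rw [e2, map_smul, map_sub, map_smul, h1, h2]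

/-- The fixed points of a 2-positive unital idempotent with a faithful invariant functional form a
star subalgebra. -/
def fixedPoints (h : IsInvertibleModel f θ e F F' 1 y X Y) : StarSubalgebra ℂ (Matrix n n ℂ) where
  carrier := {A | e A = A}
  mul_mem' := by
    intro A B hA hB
    have := h.unit_conjTranspose_mul (h.unit_conjTranspose hA) hB
    rwa [conjTranspose_conjTranspose] at this
  add_mem' := by
    intro A B hA hB
    simp only [Set.mem_ofPred_eq] at hA hB ⊢
    rw [map_add, hA, hB]
  algebraMap_mem' := by
    intro z
    simp only [Set.mem_ofPred_eq]
    rw [Algebra.algebraMap_eq_smul_one, map_smul, h.unit_posDef_left]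
  star_mem' := by
    intro A hA
    exact h.unit_conjTranspose hA

theorem mem_fixedPoints (h : IsInvertibleModel f θ e F F' 1 y X Y) {A : Matrix n n ℂ} :
    A ∈ h.fixedPoints ↔ e A = A := Iff.rfl

theorem isClosed_fixedPoints (h : IsInvertibleModel f θ e F F' 1 y X Y) :
    IsClosed (h.fixedPoints : Set (Matrix n n ℂ)) :=
  isClosed_eq (f := fun A => e A) (g := fun A => A) (by fun_prop) (by fun_prop)

theorem unit_apply (h : IsInvertibleModel f θ e F F' x y X Y) (A : Matrix n n ℂ) :
    e (F A) = F A := congrArg (fun G : MatrixEnd n => G A) h.unit_mul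

theorem inv_apply (h : IsInvertibleModel f θ e F F' x y X Y) (A : Matrix n n ℂ) :
    F' (F A) = e A := congrArg (fun G : MatrixEnd n => G A) h.inv_mul

theorem apply_inv (h : IsInvertibleModel f θ e F F' x y X Y) (A : Matrix n n ℂ) :
    F (F' A) = e A := congrArg (fun G : MatrixEnd n => G A) h.mul_inv

/-- Here 1 = F(F'(1)) ≤ ‖F'(1)‖ F(1), so F(1) has trivial kernel. -/
theorem posDef_map_one (h : IsInvertibleModel f θ e F F' 1 y X Y) : (F 1).PosDef := by
  have h0 : (0 : Matrix n n ℂ) ≤ 1 := zero_le_one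
  have h1 := h.isTwoPositive.map_mono (le_norm_smul_one (h.inv_isTwoPositive.map_nonneg h0))
  rw [h.apply_inv, h.unit_posDef_left, map_smul] at h1
  have h2 := (nonneg_iff_posSemidef.1 (h.isTwoPositive.map_nonneg h0))
  rw [h2.posDef_iff_det_ne_zero]
  intro hdet
  obtain ⟨v, hv, hv0⟩ := exists_mulVec_eq_zero_iff.2 hdet
  have := mulVec_eq_zero_of_le h0 h1 (v := v) (by rw [smul_mulVec, hv0, smul_zero])
  rw [one_mulVec] at this
  exact hv this

/-- Functional calculus of F(1); the inverse root stays in the fixed-point algebra, a closed star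
subalgebra containing F(1). -/
theorem exists_sqrt (h : IsInvertibleModel f θ e F F' 1 y X Y) :
    ∃ r s : Matrix n n ℂ, rᴴ = r ∧ sᴴ = s ∧ r * r = F 1 ∧ r * s = 1 ∧ s * r = 1 ∧ e s = s := by
  have : IsClosed (h.fixedPoints : Set (Matrix n n ℂ)) := h.isClosed_fixedPoints
  have hk := h.posDef_map_one
  have hcont : ∀ g : ℝ → ℝ, ContinuousOn g (spectrum ℝ (F 1)) := fun g =>
    (finite_real_spectrum (A := F 1)).continuousOn g
  have hpos : ∀ t ∈ spectrum ℝ (F 1), 0 < t := by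
    intro t ht
    rw [hk.isHermitian.spectrum_real_eq_range_eigenvalues] at ht
    obtain ⟨i, rfl⟩ := ht
    exact hk.eigenvalues_pos i
  have hsa : IsSelfAdjoint (F 1) := hk.isHermitian
  have hrs : cfc (fun t : ℝ => √t) (F 1) * cfc (fun t : ℝ => (√t)⁻¹) (F 1) = 1 := by
    rw [← cfc_mul _ _ _ (hcont _) (hcont _)]
    refine (cfc_congr (g := fun _ : ℝ => (1 : ℝ)) fun t ht => ?_).trans (cfc_const_one ℝ (F 1) hsa)
    exact mul_inv_cancel₀ (Real.sqrt_pos.2 (hpos t ht)).ne'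
  refine ⟨cfc (fun t : ℝ => √t) (F 1), cfc (fun t : ℝ => (√t)⁻¹) (F 1),
    (cfc_predicate (p := IsSelfAdjoint) _ _), (cfc_predicate (p := IsSelfAdjoint) _ _), ?_, hrs,
    mul_eq_one_comm.1 hrs, ?_⟩
  · rw [← cfc_mul _ _ _ (hcont _) (hcont _)]
    conv_rhs => rw [← cfc_id ℝ (F 1) hsa]
    refine cfc_congr fun t ht => ?_
    exact Real.mul_self_sqrt (hpos t ht).le
  · have hmem : F 1 ∈ h.fixedPoints := h.unit_apply 1
    exact h.mem_fixedPoints.1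
      (cfc_mem (𝕜 := ℝ) (𝕜' := ℂ) (s := h.fixedPoints) (fun t : ℝ => (√t)⁻¹) hmem)

/-- An invertible 2-positive map on the fixed points is `CᴴC ↦ (R C)ᴴ(R C)` for a linear `R`. -/
theorem exists_root (h : IsInvertibleModel f θ e F F' 1 y X Y) :
    ∃ (R : Module.End ℂ (Matrix n n ℂ)) (A : Matrix n n ℂ),
      ∀ k : ℕ, (F ^ k) X = ((R ^ k) A)ᴴ * (R ^ k) A := by
  obtain ⟨r, s, hr, hs, hrr, hrs, hsr, hes⟩ := h.exists_sqrt
  have key : ∀ C, e C = C → F (Cᴴ * C) = (s * F C)ᴴ * (s * F C) := by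
    intro C hC
    -- Normalizing by F(1)^(-1/2) gives a unital map α whose inverse α' on the fixed algebra is
    -- unital too, so the Schwarz inequality applies to both.
    set α := transportEnd s 1 F with hα
    set α' := transportEnd 1 r F' with hα'
    have hα2 : IsTwoPositive α := h.isTwoPositive.transport _ _
    have hα2' : IsTwoPositive α' := h.inv_isTwoPositive.transport _ _
    have hα_apply : ∀ A, α A = s * F A * s := fun A => by simp [hα, hs]
    have hα_apply' : ∀ A, α' A = F' (r * A * r) := fun A => by simp [hα', hr]
    have hcancel : ∀ A, r * (s * A * s) * r = A := fun A => by
      calc r * (s * A * s) * r = r * s * A * (s * r) := by simp only [Matrix.mul_assoc]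
        _ = A := by rw [hrs, hsr, Matrix.one_mul, Matrix.mul_one]
    have hcancel' : ∀ A, s * (r * A * r) * s = A := fun A => by
      calc s * (r * A * r) * s = s * r * A * (r * s) := by simp only [Matrix.mul_assoc]
        _ = A := by rw [hrs, hsr, Matrix.one_mul, Matrix.mul_one]
    have hα1 : α 1 = 1 := by
      rw [hα_apply, ← hrr]
      have := hcancel' 1
      rwa [Matrix.mul_one] at this
    have hα1' : α' 1 = 1 := by
      rw [hα_apply', Matrix.mul_one, hrr, h.inv_apply, h.unit_posDef_left]
    have hαα : ∀ A, α' (α A) = e A := fun A => by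
      rw [hα_apply', hα_apply, hcancel, h.inv_apply]
    have h1 := hα2.schwarz hα1 C
    have h2 := hα2'.schwarz hα1' (α C)
    rw [hαα, hC] at h2
    -- The defect z of α is positive, while the inequality for α' at α(C) gives α'(z) ≤ 0. Hence
    -- α'(z) = 0, and faithfulness of e forces z = 0.
    have hz : α (Cᴴ * C) - (α C)ᴴ * α C = 0 := by
      set z := α (Cᴴ * C) - (α C)ᴴ * α C with hz
      have hz0 : 0 ≤ z := sub_nonneg.2 h1
      have h3 : α' z = 0 := by
        refine le_antisymm ?_ (hα2'.map_nonneg hz0)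
        rw [hz, map_sub, hαα, h.unit_conjTranspose_mul_self hC]
        exact sub_nonpos.2 h2
      have h4 : e (r * z * r) = 0 := by
        rw [← h.apply_inv, ← hα_apply', h3, map_zero]
      have h5 : r * z * r = 0 := by
        refine h.eq_zero_of_unit_eq_zero ?_ h4
        have := conj_nonneg r hz0
        rwa [hr] at this
      rw [← hcancel' z, h5, Matrix.mul_zero, Matrix.zero_mul]
    have hCr : s * F C = α C * r := by
      rw [hα_apply, Matrix.mul_assoc, hsr, Matrix.mul_one]
    rw [hCr, conjTranspose_mul, hr]
    calc F (Cᴴ * C) = r * α (Cᴴ * C) * r := by rw [hα_apply, hcancel]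
      _ = r * ((α C)ᴴ * α C) * r := by rw [sub_eq_zero.1 hz]
      _ = r * (α C)ᴴ * (α C * r) := by simp only [Matrix.mul_assoc]
  let R : Module.End ℂ (Matrix n n ℂ) := LinearMap.mulLeft ℂ s ∘ₗ F.toLinearMap
  have hR : ∀ C, R C = s * F C := fun C => rfl
  have hRe : ∀ C, e (R C) = R C := fun C =>
    h.fixedPoints.mul_mem (h.mem_fixedPoints.2 hes) (h.mem_fixedPoints.2 (h.unit_apply C))
  have hX0 := h.nonneg_left
  have hXe : e (CFC.sqrt X) = CFC.sqrt X := by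
    have : IsClosed (h.fixedPoints : Set (Matrix n n ℂ)) := h.isClosed_fixedPoints
    rw [CFC.sqrt_eq_real_sqrt X hX0]
    rw [cfcₙ_eq_cfc]
    exact h.mem_fixedPoints.1 (cfc_mem _ (h.mem_fixedPoints.2 h.unit_left))
  have hXX : (CFC.sqrt X)ᴴ * CFC.sqrt X = X := by
    rw [(nonneg_iff_posSemidef.1 (CFC.sqrt_nonneg X)).isHermitian.eq, CFC.sqrt_mul_sqrt_self X hX0]
  refine ⟨R, CFC.sqrt X, fun k => ?_⟩
  have : (F ^ k) X = ((R ^ k) (CFC.sqrt X))ᴴ * (R ^ k) (CFC.sqrt X) ∧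
      e ((R ^ k) (CFC.sqrt X)) = (R ^ k) (CFC.sqrt X) := by
    induction k with
    | zero => exact ⟨hXX.symm, hXe⟩
    | succ k ih =>
      rw [pow_succ', pow_succ', mul_apply_eq_comp, ih.1, key _ ih.2]
      exact ⟨rfl, hRe _⟩
  exact this.1

/-- With Y = DᴴD, f(kθ) is the squared Hilbert-Schmidt norm of (R^k A) Dᴴ. Linear growth of f bounds
the norm by a multiple of √(k+1), hence by a constant, against the divergence of f(kθ). -/
theorem elim (h : IsInvertibleModel f θ e F F' x y X Y) 
    {C : ℝ} (hup : ∀ k : ℕ, f (k * θ) ≤ C * (k + 1))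
    (htop : Filter.Tendsto (fun k : ℕ => f (k * θ)) Filter.atTop Filter.atTop) : False := by
  obtain ⟨e, F, F', y, X, Y, h⟩ := h.exists_normalized
  obtain ⟨R, A, hR⟩ := h.exists_root
  obtain ⟨D, hD⟩ := CStarAlgebra.nonneg_iff_eq_star_mul_self.1 h.nonneg_right
  rw [star_eq_conjTranspose] at hD
  let Φ : Matrix n n ℂ →ₗ[ℂ] Matrix n n ℂ := LinearMap.mulRight ℂ Dᴴ
  have hΦ : ∀ k : ℕ, trace ((Φ ((R ^ k) A))ᴴ * Φ ((R ^ k) A)) = (f (k * θ) : ℂ) := by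
    intro k
    rw [← h.trace_eq k, hR, hD]
    simp only [Φ, LinearMap.mulRight_apply, conjTranspose_mul, conjTranspose_conjTranspose]
    rw [Matrix.mul_assoc Dᴴ, trace_mul_comm Dᴴ]
    simp only [Matrix.mul_assoc]
  have hlow : ∀ k : ℕ, ‖Φ ((R ^ k) A)‖ ^ 2 ≤ f (k * θ) := by
    intro k
    have h1 := norm_le_re_trace (star_mul_self_nonneg (Φ ((R ^ k) A)))
    rw [CStarRing.norm_star_mul_self, star_eq_conjTranspose, hΦ, Complex.ofReal_re] at h1
    rwa [sq]
  have hhigh : ∀ k : ℕ, f (k * θ) ≤ Fintype.card n * ‖Φ ((R ^ k) A)‖ ^ 2 := by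
    intro k
    have h1 := le_norm_smul_one (star_mul_self_nonneg (Φ ((R ^ k) A)))
    have h2 := (nonneg_iff_posSemidef.1 (sub_nonneg.2 h1)).trace_nonneg
    rw [trace_sub, sub_nonneg, CStarRing.norm_star_mul_self, star_eq_conjTranspose, hΦ, trace_smul,
      trace_one] at h2
    have h3 := (Complex.le_def.1 h2).1
    have h4 : ((‖Φ ((R ^ k) A)‖ * ‖Φ ((R ^ k) A)‖ : ℝ) • (Fintype.card n : ℂ)).re =
        Fintype.card n * ‖Φ ((R ^ k) A)‖ ^ 2 := by
      rw [Complex.real_smul, ← Complex.ofReal_natCast, ← Complex.ofReal_mul, Complex.ofReal_re]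
      ring
    rw [← h4]
    exact h3
  obtain ⟨M, hM⟩ := bounded_iterate_of_sqrt_growth (R := R) Φ (v := A) (C := √|C|) fun k => by
    rw [← Real.sqrt_mul (abs_nonneg C)]
    refine Real.le_sqrt_of_sq_le ((hlow k).trans ((hup k).trans ?_))
    exact mul_le_mul_of_nonneg_right (le_abs_self C) (by positivity)
  obtain ⟨k, hk⟩ := (htop.eventually_gt_atTop (Fintype.card n * M ^ 2)).exists
  refine hk.not_ge ((hhigh k).trans ?_)
  have := hM k
  gcongr

end IsInvertibleModel

end Root
end

noncomputable section

open scoped Matrix.Norms.L2Operator MatrixOrder ComplexOrder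
open Matrix

/-! ### From a quantum realization to a positive model -/

section Quantum

/-- For θ < 0 the value f(kθ) lies between |θ|k - 1 and |θ|k: linear growth, the case excluded by
`IsInvertibleModel.elim`. -/
theorem not_isPositiveModel_exp {n : Type} [Fintype n] [DecidableEq n]
    {S : Set (MatrixEnd n × ℝ)} {e : MatrixEnd n} {X Y : Matrix n n ℂ} :
    ¬ IsPositiveModel (fun s => Real.exp s - 1 - s) S e X Y := by
  intro h
  obtain ⟨n, _, _, θ, e, F, F', x, y, X, Y, hθ, h⟩ := exists_isInvertibleModel (by fun_prop) h
  refine h.elim (C := -θ) (fun k => ?_) ?_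
  · have h1 : Real.exp (k * θ) ≤ 1 := Real.exp_le_one_iff.2 (by
      exact mul_nonpos_of_nonneg_of_nonpos (Nat.cast_nonneg k) hθ.le)
    nlinarith
  · refine Filter.tendsto_atTop_mono (f := fun k : ℕ => -1 + -θ * k) (fun k => ?_) ?_
    · have := Real.exp_pos (k * θ)
      nlinarith
    · refine Filter.tendsto_atTop_add_const_left _ _ ?_
      exact (tendsto_natCast_atTop_atTop).const_mul_atTop (neg_pos.2 hθ)

/-- The map on matrices given by a completely positive map on operators. -/
def matrixOfCP {d : ℕ} (E : QOp d →CP QOp d) : MatrixEnd (Fin d) :=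
  LinearMap.toContinuousLinearMap
    ((toEuclideanCLM (n := Fin d) (𝕜 := ℂ)).symm.toAlgEquiv.toLinearMap ∘ₗ E.toLinearMap ∘ₗ
      (toEuclideanCLM (n := Fin d) (𝕜 := ℂ)).toAlgEquiv.toLinearMap)

theorem matrixOfCP_apply {d : ℕ} (E : QOp d →CP QOp d) (A : Matrix (Fin d) (Fin d) ℂ) :
    matrixOfCP E A = (toEuclideanCLM (n := Fin d) (𝕜 := ℂ)).symm
      (E.toLinearMap (toEuclideanCLM (n := Fin d) (𝕜 := ℂ) A)) := rfl

/-- The matrix of an operator. -/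
abbrev opMatrix {d : ℕ} : QOp d ≃⋆ₐ[ℂ] Matrix (Fin d) (Fin d) ℂ :=
  (toEuclideanCLM (n := Fin d) (𝕜 := ℂ)).symm

theorem opMatrix_star_mul {d : ℕ} (A B : QOp d) :
    opMatrix (star A * B) = (opMatrix A)ᴴ * opMatrix B := by
  have h1 : opMatrix (star A * B) = opMatrix (star A) * opMatrix B :=
    opMatrix.map_mul' _ _
  have h2 : opMatrix (star A) = (opMatrix A)ᴴ := opMatrix.map_star' A
  rw [h1, h2]

/-- Positivity in the C⋆-matrix algebra means being a sum of elements K⋆K, and such products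
translate block by block. -/
theorem fromBlocks_opMatrix_nonneg {d : ℕ} {M : CStarMatrix (Fin 2) (Fin 2) (QOp d)}
    (h : 0 ≤ M) : 0 ≤ fromBlocks (opMatrix (M 0 0)) (opMatrix (M 0 1)) (opMatrix (M 1 0))
      (opMatrix (M 1 1)) := by
  rw [StarOrderedRing.nonneg_iff] at h
  induction h using AddSubmonoid.closure_induction with
  | mem M hM =>
    obtain ⟨K, rfl⟩ := hM
    have hent : ∀ i j, opMatrix ((star K * K) i j) =
        (opMatrix (K 0 i))ᴴ * opMatrix (K 0 j) + (opMatrix (K 1 i))ᴴ * opMatrix (K 1 j) := by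
      intro i j
      rw [← opMatrix_star_mul, ← opMatrix_star_mul, CStarMatrix.mul_apply, Fin.sum_univ_two]
      exact opMatrix.map_add' _ _
    rw [hent, hent, hent, hent]
    have := star_mul_self_nonneg (fromBlocks (opMatrix (K 0 0)) (opMatrix (K 0 1))
      (opMatrix (K 1 0)) (opMatrix (K 1 1)))
    rwa [star_eq_conjTranspose, fromBlocks_conjTranspose, fromBlocks_multiply] at this
  | zero =>
    simp only [CStarMatrix.zero_apply]
    rw [show opMatrix (0 : QOp d) = 0 from map_zero _, fromBlocks_zero]
  | add M N _ _ hM hN =>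
    have hadd : ∀ i j, opMatrix ((M + N) i j) = opMatrix (M i j) + opMatrix (N i j) :=
      fun i j => opMatrix.map_add' _ _
    rw [hadd, hadd, hadd, hadd, ← fromBlocks_add]
    exact add_nonneg hM hN

theorem isTwoPositive_matrixOfCP {d : ℕ} (E : QOp d →CP QOp d) : IsTwoPositive (matrixOfCP E) := by
  intro A B C D h
  set φ := toEuclideanCLM (n := Fin d) (𝕜 := ℂ) with hφ
  obtain ⟨N, hN⟩ := CStarAlgebra.nonneg_iff_eq_star_mul_self.1 h
  rw [← fromBlocks_toBlocks N, star_eq_conjTranspose, fromBlocks_conjTranspose,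
    fromBlocks_multiply, fromBlocks_inj] at hN
  obtain ⟨hA, hB, hC, hD⟩ := hN
  have hφm : ∀ P Q R S : Matrix (Fin d) (Fin d) ℂ, φ (Pᴴ * Q + Rᴴ * S) =
      star (φ P) * φ Q + star (φ R) * φ S := by
    intro P Q R S
    have h1 : φ (Pᴴ * Q + Rᴴ * S) = φ (Pᴴ * Q) + φ (Rᴴ * S) := φ.map_add' _ _
    have h2 : ∀ P Q : Matrix (Fin d) (Fin d) ℂ, φ (Pᴴ * Q) = φ Pᴴ * φ Q :=
      fun _ _ => φ.map_mul' _ _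
    have h3 : ∀ P : Matrix (Fin d) (Fin d) ℂ, φ Pᴴ = star (φ P) :=
      fun _ => φ.map_star' _
    rw [h1, h2, h2, h3, h3]
  let K : CStarMatrix (Fin 2) (Fin 2) (QOp d) :=
    CStarMatrix.ofMatrix !![φ N.toBlocks₁₁, φ N.toBlocks₁₂; φ N.toBlocks₂₁, φ N.toBlocks₂₂]
  let M : CStarMatrix (Fin 2) (Fin 2) (QOp d) := CStarMatrix.ofMatrix !![φ A, φ B; φ C, φ D]
  have hM : M = star K * K := by
    refine CStarMatrix.ext fun i j => ?_
    rw [CStarMatrix.mul_apply, Fin.sum_univ_two, CStarMatrix.star_apply, CStarMatrix.star_apply]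
    fin_cases i <;> fin_cases j
    · exact (congrArg φ hA).trans (hφm _ _ _ _)
    · exact (congrArg φ hB).trans (hφm _ _ _ _)
    · exact (congrArg φ hC).trans (hφm _ _ _ _)
    · exact (congrArg φ hD).trans (hφm _ _ _ _)
  have hM0 : 0 ≤ M := by
    rw [hM]
    exact star_mul_self_nonneg K
  -- Complete positivity enters only through its 2×2 amplification.
  have hpos := fromBlocks_opMatrix_nonneg (E.map_cstarMatrix_nonneg' 2 M hM0)
  have e00 : opMatrix ((M.map E.toLinearMap) 0 0) = matrixOfCP E A := rfl
  have e01 : opMatrix ((M.map E.toLinearMap) 0 1) = matrixOfCP E B := rfl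
  have e10 : opMatrix ((M.map E.toLinearMap) 1 0) = matrixOfCP E C := rfl
  have e11 : opMatrix ((M.map E.toLinearMap) 1 1) = matrixOfCP E D := rfl
  rwa [e00, e01, e10, e11] at hpos

theorem qTrace_toEuclideanCLM {d : ℕ} (A : Matrix (Fin d) (Fin d) ℂ) :
    qTrace (toEuclideanCLM (n := Fin d) (𝕜 := ℂ) A) = trace A := by
  have : (toEuclideanCLM (n := Fin d) (𝕜 := ℂ) A).toLinearMap = toEuclideanLin A := rfl
  rw [qTrace, this, toEuclideanLin_eq_toLin_orthonormal, trace_toLin_eq]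

/-- A quantum realization, written in terms of matrices. -/
theorem HasQuantumRealization.exists_matrix {α : Type*} [Fintype α] {p : FreeMonoid α → ℝ}
    (h : HasQuantumRealization p) :
    ∃ (d : ℕ) (P : Matrix (Fin d) (Fin d) ℂ) (G : α → MatrixEnd (Fin d)), 0 ≤ P ∧
      (∀ u, IsTwoPositive (G u)) ∧
      ∀ w, (p w : ℂ) = trace (P * (FreeMonoid.lift G w) 1) := by
  obtain ⟨d, ρ, E, hρ, -, -, -, hp⟩ := h
  set φ := toEuclideanCLM (n := Fin d) (𝕜 := ℂ) with hφ
  refine ⟨d, φ.symm ρ, fun u => matrixOfCP (E u), ?_, fun u => isTwoPositive_matrixOfCP _, ?_⟩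
  · obtain ⟨K, hK⟩ := CStarAlgebra.nonneg_iff_eq_star_mul_self.1
      (ContinuousLinearMap.nonneg_iff_isPositive ρ |>.2 hρ)
    rw [hK]
    exact (star_mul_self_nonneg (opMatrix K)).trans_eq (opMatrix_star_mul K K).symm
  · have hword : ∀ (w : FreeMonoid α) (A : Matrix (Fin d) (Fin d) ℂ),
        qWordMap E w (φ A) = φ (FreeMonoid.lift (fun u => matrixOfCP (E u)) w A) := by
      intro w
      induction w using FreeMonoid.inductionOn' with
      | one => intro A; simp
      | of_mul u w ih =>
        intro A
        rw [map_mul, map_mul, Module.End.mul_apply, mul_apply_eq_comp, ih, FreeMonoid.lift_eval_of,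
          matrixOfCP_apply, ← hφ, StarAlgEquiv.apply_symm_apply, qWordMap, FreeMonoid.lift_eval_of]
    intro w
    have h1 : φ 1 = 1 := map_one φ
    have h2 := hword w 1
    rw [h1] at h2
    rw [hp, ← qTrace_toEuclideanCLM, ← hφ, map_mul φ, ← h2, StarAlgEquiv.apply_symm_apply]

/-- The sum of the weights of the letters of a word. -/
def wordSum {α : Type*} (l : α → ℝ) (w : FreeMonoid α) : ℝ := (w.toList.map l).sum

@[simp]
theorem wordSum_one {α : Type*} (l : α → ℝ) : wordSum l 1 = 0 := rfl

@[simp]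
theorem wordSum_of {α : Type*} (l : α → ℝ) (u : α) : wordSum l (FreeMonoid.of u) = l u := by
  simp [wordSum]

@[simp]
theorem wordSum_mul {α : Type*} (l : α → ℝ) (v w : FreeMonoid α) :
    wordSum l (v * w) = wordSum l v + wordSum l w := by
  simp [wordSum, FreeMonoid.toList_mul]

theorem lift_smul_apply {α : Type*} {d : ℕ} (G : α → MatrixEnd (Fin d)) (c : ℂ)
    (w : FreeMonoid α) :
    FreeMonoid.lift (fun u => c • G u) w = c ^ w.length • FreeMonoid.lift G w := by
  induction w using FreeMonoid.inductionOn' with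
  | one => simp
  | of_mul u w ih =>
    rw [map_mul, map_mul, ih, FreeMonoid.lift_eval_of, FreeMonoid.lift_eval_of,
      FreeMonoid.length_mul, FreeMonoid.length_of, pow_add, pow_one]
    ext1 A
    simp only [mul_apply_eq_comp, _root_.smul_apply, map_smul, smul_smul]
    rw [mul_comm]

theorem isTwoPositive_lift {α : Type*} {d : ℕ} {G : α → MatrixEnd (Fin d)}
    (hG : ∀ u, IsTwoPositive (G u)) (w : FreeMonoid α) : IsTwoPositive (FreeMonoid.lift G w) := by
  induction w using FreeMonoid.inductionOn' with
  | one => rw [map_one]; exact IsTwoPositive.one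
  | of_mul u w ih => rw [map_mul, FreeMonoid.lift_eval_of]; exact (hG u).comp ih

/-- The two resets become the fixed matrices X = G₀(1) and Y, a multiple of the adjoint of G₀ at the
state; the words between them, rescaled by powers of ν, form the graded semigroup. -/
theorem not_hasQuantumRealization {p : FreeMonoid (Fin 3) → ℝ} {l : Fin 2 → ℝ} {ν κ : ℝ}
    (hν : 0 < ν) (hκ : 0 < κ) (hl : Dense (Set.range (wordSum l)))
    (hp : ∀ w : FreeMonoid (Fin 2),
      p (FreeMonoid.of 0 * FreeMonoid.map Fin.succ w * FreeMonoid.of 0) =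
        κ * ν ^ w.length * (Real.exp (wordSum l w) - 1 - wordSum l w)) :
    ¬ HasQuantumRealization p := by
  intro h
  obtain ⟨d, P, G, hP, hG, hpG⟩ := h.exists_matrix
  let H : Fin 2 → MatrixEnd (Fin d) := fun i => ((ν⁻¹ : ℝ) : ℂ) • G i.succ
  have hH : ∀ i, IsTwoPositive (H i) := fun i => (hG _).smul (inv_nonneg.2 hν.le)
  have hword : ∀ w : FreeMonoid (Fin 2), FreeMonoid.lift H w =
      ((ν⁻¹ : ℝ) : ℂ) ^ w.length • FreeMonoid.lift G (FreeMonoid.map Fin.succ w) := by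
    intro w
    rw [lift_smul_apply]
    congr 1
    induction w using FreeMonoid.inductionOn' with
    | one => simp
    | of_mul u w ih => simp only [map_mul, FreeMonoid.lift_eval_of, FreeMonoid.map_of, ih]
  let S : Set (MatrixEnd (Fin d) × ℝ) := Set.range fun w => (FreeMonoid.lift H w, wordSum l w)
  refine not_isPositiveModel_exp (S := S) (e := 1) (X := G 0 1)
    (Y := ((κ⁻¹ : ℝ) : ℂ) • traceAdjoint (G 0) P) ?_
  exact
    { isTwoPositive := by
        rintro _ ⟨w, rfl⟩
        exact isTwoPositive_lift hH w
      mul_mem := by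
        rintro _ ⟨v, rfl⟩ _ ⟨w, rfl⟩
        exact ⟨v * w, by simp⟩
      unit_mem := ⟨1, by simp⟩
      unit_mul := fun _ _ => one_mul _
      mul_unit := fun _ _ => mul_one _
      nonneg_left := (hG 0).map_nonneg zero_le_one
      nonneg_right := smul_nonneg (by exact_mod_cast inv_nonneg.2 hκ.le)
        ((hG 0).traceAdjoint.map_nonneg hP)
      unit_left := rfl
      unit_right := by
        refine eq_of_trace_mul_eq fun C => ?_
        rw [trace_traceAdjoint_mul]
        rfl
      trace_eq := by
        rintro _ ⟨w, rfl⟩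
        have h1 := hpG (FreeMonoid.of 0 * FreeMonoid.map Fin.succ w * FreeMonoid.of 0)
        rw [map_mul, map_mul, FreeMonoid.lift_eval_of, mul_apply_eq_comp, mul_apply_eq_comp,
          ← trace_traceAdjoint_mul, hp] at h1
        simp only [hword]
        rw [Matrix.smul_mul, trace_smul, _root_.smul_apply, Matrix.mul_smul,
          trace_smul, ← h1, smul_eq_mul, smul_eq_mul]
        have hν' : (ν : ℂ) ≠ 0 := by exact_mod_cast hν.ne'
        have hκ' : (κ : ℂ) ≠ 0 := by exact_mod_cast hκ.ne'
        push_cast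
        field_simp
        rw [one_div, inv_pow, inv_mul_cancel₀ (pow_ne_zero _ hν'), one_mul]
      dense := by
        have : Prod.snd '' S = Set.range (wordSum l) := by
          rw [← Set.range_comp]; rfl
        rw [this]
        exact hl }

end Quantum
end

noncomputable section

/-! ### A stationary law on paths from consistent word probabilities -/

section PathLaw

set_option linter.unusedSectionVars false

open MeasureTheory Filter Topology

variable {α : Type*} [Fintype α] [MeasurableSpace α] [DiscreteMeasurableSpace α]

/-- The paths that start with the word `w`. -/
def pathCylinder {α : Type*} (t : ℕ) (w : List α) : Set (ℕ → α) :=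
  {y | ∀ i : Fin w.length, y (t + i) = w.get i}

/-- The path `u, y 0, y 1, …`. -/
def consPath {α : Type*} (u : α) (y : ℕ → α) : ℕ → α
  | 0 => u
  | n + 1 => y n

theorem pathCylinder_nil {α : Type*} (t : ℕ) : pathCylinder t ([] : List α) = Set.univ := by
  ext y
  simp [pathCylinder]

theorem mem_pathCylinder_cons {α : Type*} {t : ℕ} {u : α} {w : List α} {y : ℕ → α} :
    y ∈ pathCylinder t (u :: w) ↔ y t = u ∧ y ∈ pathCylinder (t + 1) w := by
  simp only [pathCylinder, Set.mem_ofPred_eq, List.length_cons, Fin.forall_fin_succ]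
  simp [add_assoc, add_comm 1]

theorem consPath_mem_pathCylinder {α : Type*} {t : ℕ} {u : α} {w : List α} {y : ℕ → α} :
    consPath u y ∈ pathCylinder (t + 1) w ↔ y ∈ pathCylinder t w := by
  simp only [pathCylinder, Set.mem_ofPred_eq]
  refine forall_congr' fun i => ?_
  rw [add_right_comm]
  rfl

theorem measurableSet_pathCylinder (t : ℕ) (w : List α) :
    MeasurableSet (pathCylinder t w) := by
  rw [pathCylinder, Set.ofPred_forall]
  refine MeasurableSet.iInter fun i => ?_
  exact measurable_pi_apply (X := fun _ : ℕ => α) (t + (i : ℕ))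
    (MeasurableSet.singleton (w.get i))

theorem measurable_consPath (u : α) : Measurable (consPath u) := by
  refine measurable_pi_lambda _ fun n => ?_
  cases n with
  | zero => exact measurable_const
  | succ n => exact measurable_pi_apply n

/-- The measure of mass `p v` on the paths that follow the law of the continuations of `v` for
`n` steps. -/
def stepMeasure [Inhabited α] (p : FreeMonoid α → ℝ) : ℕ → FreeMonoid α → Measure (ℕ → α)
  | 0, v => ENNReal.ofReal (p v) • Measure.dirac default
  | n + 1, v => ∑ u : α, (stepMeasure p n (v * FreeMonoid.of u)).map (consPath u)

/-- Only the branch prepending the first letter of w meets the cylinder. After n steps the path is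
constantly `default`, hence the bound on the length. -/
theorem stepMeasure_pathCylinder [Inhabited α] {p : FreeMonoid α → ℝ} (h0 : ∀ w, 0 ≤ p w)
    (hr : ∀ w, ∑ u, p (w * FreeMonoid.of u) = p w) (n : ℕ) (v : FreeMonoid α) (w : List α)
    (hw : w.length ≤ n) :
    stepMeasure p n v (pathCylinder 0 w) = ENNReal.ofReal (p (v * FreeMonoid.ofList w)) := by
  classical
  induction n generalizing v w with
  | zero =>
    obtain rfl : w = [] := List.length_eq_zero_iff.1 (Nat.le_zero.1 hw)
    rw [pathCylinder_nil, stepMeasure]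
    simp
  | succ n ih =>
    rw [stepMeasure, Measure.finsetSum_apply]
    have hmap : ∀ u, (stepMeasure p n (v * FreeMonoid.of u)).map (consPath u) (pathCylinder 0 w) =
        stepMeasure p n (v * FreeMonoid.of u) (consPath u ⁻¹' pathCylinder 0 w) := fun u =>
      Measure.map_apply (measurable_consPath u) (measurableSet_pathCylinder 0 w)
    simp only [hmap]
    cases w with
    | nil =>
      have : ∀ u, stepMeasure p n (v * FreeMonoid.of u) (consPath u ⁻¹' pathCylinder 0 []) =
          ENNReal.ofReal (p (v * FreeMonoid.of u)) := fun u => by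
        have := ih (v * FreeMonoid.of u) [] (Nat.zero_le _)
        rw [pathCylinder_nil] at this ⊢
        simpa using this
      simp only [this]
      rw [← ENNReal.ofReal_sum_of_nonneg fun u _ => h0 _, hr]
      simp
    | cons a w =>
      rw [Finset.sum_eq_single a]
      · have : consPath a ⁻¹' pathCylinder 0 (a :: w) = pathCylinder 0 w := by
          ext y
          rw [Set.mem_preimage, mem_pathCylinder_cons, consPath_mem_pathCylinder]
          simp [consPath]
        rw [this, ih _ _ (by simpa using hw), mul_assoc, FreeMonoid.ofList_cons]
      · intro u _ hu
        have : consPath u ⁻¹' pathCylinder 0 (a :: w) = ∅ := by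
          ext y
          rw [Set.mem_preimage, mem_pathCylinder_cons]
          simp [consPath, hu]
        rw [this, measure_empty]
      · simp

/-- The path space is compact, so the laws of n steps have a weak limit along an ultrafilter.
Cylinders are clopen, so their measures pass to the limit, and these are constant from n = |w| on.
-/
theorem exists_measure_pathCylinder [Inhabited α] {p : FreeMonoid α → ℝ} (h0 : ∀ w, 0 ≤ p w)
    (h1 : p 1 = 1) (hr : ∀ w, ∑ u, p (w * FreeMonoid.of u) = p w) :
    ∃ P : Measure (ℕ → α), IsProbabilityMeasure P ∧
      ∀ w : List α, P (pathCylinder 0 w) = ENNReal.ofReal (p (FreeMonoid.ofList w)) := by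
  let _ : TopologicalSpace α := ⊥
  have : DiscreteTopology α := ⟨rfl⟩
  have : BorelSpace α := inferInstance
  have hprob : ∀ n, IsProbabilityMeasure (stepMeasure p n 1) := fun n => ⟨by
    have := stepMeasure_pathCylinder h0 hr n 1 [] (Nat.zero_le _)
    rw [pathCylinder_nil] at this
    rw [this]
    simp [h1]⟩
  let μ : ℕ → ProbabilityMeasure (ℕ → α) := fun n => ⟨stepMeasure p n 1, hprob n⟩
  let 𝒰 : Ultrafilter ℕ := hyperfilter ℕ
  obtain ⟨P, -, hP⟩ := isCompact_univ.ultrafilter_le_nhds (𝒰.map μ) (by simp)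
  have hlim : Tendsto μ 𝒰 (𝓝 P) := hP
  refine ⟨P, inferInstance, fun w => ?_⟩
  have hclopen : IsClopen (pathCylinder 0 w) := by
    rw [pathCylinder, Set.ofPred_forall]
    exact isClopen_iInter_of_finite fun i =>
      (isClopen_discrete {w.get i}).preimage (continuous_apply (0 + (i : ℕ)))
  have ht := ProbabilityMeasure.tendsto_measure_of_null_frontier_of_tendsto' hlim
    (E := pathCylinder 0 w) (by rw [hclopen.frontier_eq]; simp)
  refine tendsto_nhds_unique ht ?_
  refine Tendsto.congr' (f₁ := fun _ => ENNReal.ofReal (p (FreeMonoid.ofList w))) ?_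
    tendsto_const_nhds
  have : ∀ᶠ n in (atTop : Filter ℕ), ENNReal.ofReal (p (FreeMonoid.ofList w)) =
      (μ n : Measure (ℕ → α)) (pathCylinder 0 w) := by
    filter_upwards [eventually_ge_atTop w.length] with n hn
    have := stepMeasure_pathCylinder h0 hr n 1 w hn
    rw [one_mul] at this
    exact this.symm
  exact this.filter_mono (by rw [← Nat.cofinite_eq_atTop]; exact hyperfilter_le_cofinite)

/-- A family of nonnegative consistent and shift-invariant word probabilities belongs to a
stationary process. -/
theorem isStationaryProcess_of_consistent [Inhabited α] {p : FreeMonoid α → ℝ}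
    (h0 : ∀ w, 0 ≤ p w) (h1 : p 1 = 1) (hr : ∀ w, ∑ u, p (w * FreeMonoid.of u) = p w)
    (hl : ∀ w, ∑ u, p (FreeMonoid.of u * w) = p w) : IsStationaryProcess p := by
  obtain ⟨P, hP, hcyl⟩ := exists_measure_pathCylinder h0 h1 hr
  refine ⟨P, hP, fun t w => ?_⟩
  suffices h : ∀ w : List α, P (pathCylinder t w) = ENNReal.ofReal (p (FreeMonoid.ofList w)) by
    have := h w.toList
    rw [FreeMonoid.ofList_toList] at this
    exact (congrArg ENNReal.toReal this).trans (ENNReal.toReal_ofReal (h0 w))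
  induction t with
  | zero => exact hcyl
  | succ t ih =>
    intro w
    -- Splitting by the letter at time t reduces time t + 1 to time t; invariance under prepending a
    -- letter sums the pieces.
    have hU : pathCylinder (t + 1) w = ⋃ u : α, pathCylinder t (u :: w) := by
      ext y
      simp [mem_pathCylinder_cons]
    rw [hU, measure_iUnion _ fun u => measurableSet_pathCylinder _ _, tsum_fintype]
    · simp only [ih, FreeMonoid.ofList_cons]
      rw [← ENNReal.ofReal_sum_of_nonneg fun u _ => h0 _, hl]
    · intro u v huv
      refine Set.disjoint_left.2 fun y hy hy' => huv ?_
      rw [mem_pathCylinder_cons] at hy hy'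
      exact hy.1.symm.trans hy'.1

end PathLaw
end

noncomputable section

/-! ### Density of the times reached by words -/

section Density

/-- Dirichlet approximation makes kx - jy small with k ≥ 1. The signs being opposite, j ≥ 1 would
give |kx - jy| ≥ |x|, so j ≤ 0 and (k-1)x - jy is an element of S close to -x. -/
theorem AddSubmonoid.neg_mem_closure_of_mul_neg {S : AddSubmonoid ℝ} {x y : ℝ} (hx : x ∈ S)
    (hy : y ∈ S) (hxy : x * y < 0) : -x ∈ _root_.closure (S : Set ℝ) := by
  have hx0 : x ≠ 0 := by rintro rfl; simp at hxy
  have hy0 : y ≠ 0 := by rintro rfl; simp at hxy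
  rw [Metric.mem_closure_iff]
  intro ε hε
  obtain ⟨n, hn⟩ := exists_nat_gt (|y| / min ε |x|)
  have hδ : 0 < min ε |x| := lt_min hε (abs_pos.2 hx0)
  have hn0 : 0 < n := by
    have : (0 : ℝ) < n := lt_of_le_of_lt (by positivity) hn
    exact_mod_cast this
  obtain ⟨j, k, hk, -, hjk⟩ := Real.exists_int_int_abs_mul_sub_le (x / y) hn0
  have hlt : |k * x - j * y| < min ε |x| := by
    have h1 : |k * x - j * y| = |k * (x / y) - j| * |y| := by
      rw [← abs_mul]; congr 1; field_simp
    have h2 : |y| < n * min ε |x| := (div_lt_iff₀ hδ).1 hn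
    have h3 : |k * (x / y) - j| * |y| ≤ 1 / (n + 1) * |y| := by gcongr
    have h4 : 1 / ((n : ℝ) + 1) * |y| < min ε |x| := by
      rw [one_div, inv_mul_lt_iff₀ (by positivity)]
      nlinarith
    linarith
  have hk1 : (1 : ℝ) ≤ k := by exact_mod_cast hk
  have hj : j ≤ 0 := by
    by_contra! hj
    have hj1 : (1 : ℝ) ≤ j := by exact_mod_cast hj
    have h1 : |x| ≤ |k * x - j * y| := by
      rw [← sq_le_sq]
      have h2 : 0 ≤ (k * j : ℝ) * -(x * y) :=
        mul_nonneg (by positivity) (neg_nonneg.2 hxy.le)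
      have h3 : 0 ≤ ((k : ℝ) ^ 2 - 1) * x ^ 2 :=
        mul_nonneg (by nlinarith) (sq_nonneg x)
      nlinarith [sq_nonneg (j * y)]
    exact absurd (lt_of_le_of_lt h1 hlt) (by simp)
  obtain ⟨k', rfl⟩ : ∃ k' : ℕ, k = k' + 1 := ⟨(k - 1).toNat, by omega⟩
  obtain ⟨j', rfl⟩ : ∃ j' : ℕ, j = -j' := ⟨(-j).toNat, by omega⟩
  refine ⟨k' • x + j' • y, add_mem (nsmul_mem hx _) (nsmul_mem hy _), ?_⟩
  refine lt_of_eq_of_lt ?_ (lt_of_lt_of_le hlt (min_le_left _ _))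
  rw [dist_comm, Real.dist_eq]
  congr 1
  push_cast
  simp only [nsmul_eq_mul]
  ring

/-- The group generated by x and y is dense, and it lies in the closure of S because -x and -y do.
-/
theorem AddSubmonoid.dense_of_irrational {S : AddSubmonoid ℝ} {x y : ℝ} (hx : x ∈ S) (hy : y ∈ S)
    (hxy : x * y < 0) (hirr : Irrational (x / y)) : Dense (S : Set ℝ) := by
  have h := dense_addSubgroupClosure_pair_iff.2 hirr
  rw [← dense_closure]
  refine h.mono ?_
  have hle : (AddSubgroup.closure ({x, y} : Set ℝ)).toAddSubmonoid ≤ S.topologicalClosure := by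
    rw [AddSubgroup.closure_toAddSubmonoid, AddSubmonoid.closure_le]
    rintro z (hz | hz)
    · rcases hz with rfl | rfl
      · exact _root_.subset_closure hx
      · exact _root_.subset_closure hy
    · rcases hz with hz | hz
      · have hz : -z = x := hz
        rw [neg_eq_iff_eq_neg.1 hz]
        exact S.neg_mem_closure_of_mul_neg hx hy hxy
      · have hz : -z = y := hz
        rw [neg_eq_iff_eq_neg.1 hz]
        exact S.neg_mem_closure_of_mul_neg hy hx (by rwa [mul_comm])
  exact hle

theorem irrational_log_half_div_log_three : Irrational (Real.log (1 / 2) / Real.log 3) := by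
  rintro ⟨q, hq⟩
  have h3 : 0 < Real.log 3 := Real.log_pos (by norm_num)
  have h2 : 0 < Real.log 2 := Real.log_pos (by norm_num)
  rw [one_div, Real.log_inv, eq_div_iff h3.ne'] at hq
  have hden : (0 : ℝ) < q.den := by exact_mod_cast q.den_pos
  have hq' : (q : ℝ) = q.num / q.den := by exact_mod_cast (Rat.num_div_den q).symm
  have hmul : (q.den : ℝ) * Real.log 2 = ((-q.num : ℤ) : ℝ) * Real.log 3 := by
    rw [hq'] at hq
    field_simp at hq
    push_cast
    linarith
  have hnum : 0 < -q.num := by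
    have : (0 : ℝ) < ((-q.num : ℤ) : ℝ) := by
      by_contra! h
      nlinarith [mul_pos hden h2, mul_nonneg (neg_nonneg.2 h) h3.le]
    exact_mod_cast this
  obtain ⟨m, hm⟩ : ∃ m : ℕ, -q.num = m := ⟨(-q.num).toNat, by omega⟩
  rw [hm, Int.cast_natCast, ← Real.log_pow, ← Real.log_pow] at hmul
  have heq : (2 : ℝ) ^ q.den = 3 ^ m :=
    Real.log_injOn_pos (by simp) (by simp) hmul
  have heq' : 2 ^ q.den = 3 ^ m := by exact_mod_cast heq
  have hodd : Odd (3 ^ m) := Odd.pow (by decide)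
  rw [← heq'] at hodd
  exact (Nat.not_odd_iff_even.2 ((Nat.even_pow' q.den_nz).2 (by decide))) hodd

theorem dense_range_wordSum_log :
    Dense (Set.range (wordSum ![Real.log (1 / 2), Real.log 3])) := by
  let S : AddSubmonoid ℝ :=
    { carrier := Set.range (wordSum ![Real.log (1 / 2), Real.log 3])
      add_mem' := by
        rintro _ _ ⟨v, rfl⟩ ⟨w, rfl⟩
        exact ⟨v * w, wordSum_mul _ _ _⟩
      zero_mem' := ⟨1, rfl⟩ }
  refine AddSubmonoid.dense_of_irrational (S := S) ⟨FreeMonoid.of 0, rfl⟩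
    ⟨FreeMonoid.of 1, rfl⟩ ?_ ?_
  · simp only [wordSum_of, Matrix.cons_val_zero, Matrix.cons_val_one]
    exact mul_neg_of_neg_of_pos (Real.log_neg (by norm_num) (by norm_num))
      (Real.log_pos (by norm_num))
  · simpa using irrational_log_half_div_log_three

end Density

end

noncomputable section

/-! ### The exponential cone: dual description, flow and extremality -/

section ExponentialCone

open Matrix Filter Topology

/-- The half-spaces are bounded by the tangent planes along the curve (e^u, 1, u); on the slice x₂ =
1 this is e^u ≥ 1 + u shifted by s. The converse uses the tangent at s = -x₃/x₂, and s → -∞ or large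
s when x₂ ≤ 0. -/
theorem mem_expCone_iff {x : Fin 3 → ℝ} :
    x ∈ expCone ↔ ∀ s : ℝ, 0 ≤ Real.exp s * x 0 - (1 + s) * x 1 - x 2 := by
  constructor
  · rintro (⟨h1, h⟩ | ⟨h1, h0, h2⟩) s
    · rw [le_div_iff₀ h1] at h
      have h3 : s + x 2 / x 1 + 1 ≤ Real.exp s * Real.exp (x 2 / x 1) := by
        rw [← Real.exp_add]; exact Real.add_one_le_exp _
      have h4 := mul_le_mul_of_nonneg_right h3 h1.le
      have h5 := mul_le_mul_of_nonneg_left h (Real.exp_pos s).le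
      have h6 : x 2 / x 1 * x 1 = x 2 := div_mul_cancel₀ _ h1.ne'
      nlinarith
    · rw [h1]
      have := mul_nonneg (Real.exp_pos s).le h0
      linarith
  · intro h
    rcases lt_trichotomy (x 1) 0 with h1 | h1 | h1
    · exfalso
      -- This s is so negative that the term (1 + s) x₂ outweighs both other terms.
      have hq : 0 ≤ (|x 0| + |x 2| + 1) / -x 1 := div_nonneg (by positivity) (by linarith)
      have hs := h (-(1 + (|x 0| + |x 2| + 1) / -x 1))
      have h2 : Real.exp (-(1 + (|x 0| + |x 2| + 1) / -x 1)) ≤ 1 :=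
        Real.exp_le_one_iff.2 (by linarith)
      have h3 : (|x 0| + |x 2| + 1) / -x 1 * x 1 = -(|x 0| + |x 2| + 1) := by
        rw [div_neg, neg_mul, div_mul_cancel₀ _ h1.ne]
      have h4 : Real.exp (-(1 + (|x 0| + |x 2| + 1) / -x 1)) * x 0 ≤ |x 0| := by
        calc _ ≤ Real.exp (-(1 + (|x 0| + |x 2| + 1) / -x 1)) * |x 0| := by
              gcongr; exact le_abs_self _
          _ ≤ 1 * |x 0| := by gcongr
          _ = |x 0| := one_mul _
      have h5 := neg_abs_le (x 2)
      nlinarith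
    · refine Or.inr ⟨h1, ?_, ?_⟩
      · by_contra! h0
        have hs := h (Real.log ((|x 2| + 1) / -x 0))
        rw [Real.exp_log (div_pos (by positivity) (by linarith)), h1] at hs
        have h3 : (|x 2| + 1) / -x 0 * x 0 = -(|x 2| + 1) := by
          rw [div_neg, neg_mul, div_mul_cancel₀ _ h0.ne]
        have h5 := neg_abs_le (x 2)
        linarith
      · have ht : Tendsto (fun s : ℝ => Real.exp s * x 0 - x 2) atBot (𝓝 (0 * x 0 - x 2)) :=
          (Real.tendsto_exp_atBot.mul_const _).sub_const _
        have := ge_of_tendsto' ht (b := 0) fun s => by simpa [h1] using h s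
        linarith
    · refine Or.inl ⟨h1, ?_⟩
      have hs := h (-(x 2 / x 1))
      rw [le_div_iff₀ h1]
      have h6 : x 2 / x 1 * x 1 = x 2 := div_mul_cancel₀ _ h1.ne'
      have h7 : x 1 ≤ Real.exp (-(x 2 / x 1)) * x 0 := by linarith
      have h8 := mul_le_mul_of_nonneg_left h7 (Real.exp_pos (x 2 / x 1)).le
      rwa [← mul_assoc, ← Real.exp_add, add_neg_cancel, Real.exp_zero, one_mul] at h8

theorem nonneg_of_mem_expCone {x : Fin 3 → ℝ} (hx : x ∈ expCone) : 0 ≤ x 0 := by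
  rcases hx with ⟨h1, h⟩ | ⟨-, h0, -⟩
  · rw [le_div_iff₀ h1] at h
    exact (by positivity : (0 : ℝ) ≤ _).trans h
  · exact h0

theorem isClosed_expCone : IsClosed expCone := by
  have : expCone = ⋂ s : ℝ, {x | 0 ≤ Real.exp s * x 0 - (1 + s) * x 1 - x 2} := by
    ext x
    simp [mem_expCone_iff]
  rw [this]
  exact isClosed_iInter fun s => isClosed_le continuous_const (by fun_prop)

/-- `expCone` as a convex cone. -/
def expConvexCone : ConvexCone ℝ (Fin 3 → ℝ) where
  carrier := expCone
  smul_mem' := by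
    intro c hc x hx
    rw [mem_expCone_iff] at hx ⊢
    intro s
    have := mul_nonneg hc.le (hx s)
    simp only [Pi.smul_apply, smul_eq_mul]
    linarith
  add_mem' := by
    intro x hx y hy
    rw [mem_expCone_iff] at hx hy ⊢
    intro s
    have := add_nonneg (hx s) (hy s)
    simp only [Pi.add_apply]
    linarith

theorem eq_zero_of_mem_expCone_of_neg_mem {x : Fin 3 → ℝ} (hx : x ∈ expCone)
    (hx' : -x ∈ expCone) : x = 0 := by
  have h0 := nonneg_of_mem_expCone hx
  have h0' := nonneg_of_mem_expCone hx'
  rw [mem_expCone_iff] at hx hx'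
  have h1 := hx 0
  have h2 := hx' 0
  have h3 := hx 1
  have h4 := hx' 1
  simp only [Pi.neg_apply] at *
  have e0 : x 0 = 0 := by linarith
  rw [e0] at h1 h2 h3 h4
  have e1 : x 1 = 0 := by linarith
  have e2 : x 2 = 0 := by linarith
  ext i
  fin_cases i <;> assumption

/-- The one-parameter group of automorphisms of `expCone` to which the matrices `expMatrix` belong,
up to scaling. -/
def expFlow (s : ℝ) : Matrix (Fin 3) (Fin 3) ℝ := !![Real.exp s, 0, 0; 0, 1, 0; 0, s, 1]

theorem expFlow_mulVec (s : ℝ) (x : Fin 3 → ℝ) :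
    expFlow s *ᵥ x = ![Real.exp s * x 0, x 1, s * x 1 + x 2] := by
  ext i
  fin_cases i <;> simp [expFlow, mulVec, dotProduct, Fin.sum_univ_three]

theorem expFlow_zero : expFlow 0 = 1 := by
  ext i j
  fin_cases i <;> fin_cases j <;> simp [expFlow]

theorem expFlow_mul (s t : ℝ) : expFlow s * expFlow t = expFlow (s + t) := by
  ext i j
  fin_cases i <;> fin_cases j <;>
    simp [expFlow, Matrix.mul_apply, Fin.sum_univ_three, Real.exp_add]

theorem expMatrix_eq {ν c : ℝ} (hc : 0 < c) : expMatrix ν c = ν • expFlow (Real.log c) := by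
  rw [expMatrix, expFlow, Real.exp_log hc]

/-- The transposed flow translates the parameter of the tangent functionals, so it permutes them. -/
theorem expFlow_mulVec_mem {s : ℝ} {x : Fin 3 → ℝ} (hx : x ∈ expCone) :
    expFlow s *ᵥ x ∈ expCone := by
  rw [mem_expCone_iff] at hx ⊢
  intro t
  have := hx (s + t)
  rw [Real.exp_add] at this
  simp only [expFlow_mulVec, cons_val_zero, cons_val_one, cons_val]
  linarith

/-- The homomorphism `expD` with the reset given by `m₀ = (1, 1, 0)` and `μ₀ = (1, -1, -1)`. -/
abbrev coneD (ν a b : ℝ) : FreeMonoid (Fin 3) →* Module.End ℝ (Fin 3 → ℝ) :=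
  expD ν a b ![1, 1, 0] ![1, -1, -1]

variable {ν a b : ℝ}

/-- The reset vector is the point s = 0 of the curve (e^s, 1, s), and the reset functional is the
tangent functional at s = 0. -/
theorem coneD_zero_apply (x : Fin 3 → ℝ) :
    coneD ν a b (FreeMonoid.of 0) x = (ν * (x 0 - x 1 - x 2)) • ![1, 1, 0] := by
  ext i
  fin_cases i <;>
    simp [coneD, expD, resetMatrix, mulVec, dotProduct, Fin.sum_univ_three] <;>
    ring

theorem coneD_map_succ_apply (ha : 0 < a) (hb : 0 < b) (w : FreeMonoid (Fin 2)) (x : Fin 3 → ℝ) :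
    coneD ν a b (FreeMonoid.map Fin.succ w) x =
      ν ^ w.length • (expFlow (wordSum ![Real.log a, Real.log b] w) *ᵥ x) := by
  induction w using FreeMonoid.inductionOn' with
  | one => simp [expFlow_zero]
  | of_mul u w ih =>
    rw [map_mul, map_mul, Module.End.mul_apply, ih, wordSum_mul, ← expFlow_mul, FreeMonoid.map_of,
      FreeMonoid.length_mul, FreeMonoid.length_of, pow_add, pow_one, ← mulVec_mulVec, wordSum_of]
    have : coneD ν a b (FreeMonoid.of u.succ) =
        toLin' (ν • expFlow (![Real.log a, Real.log b] u)) := by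
      fin_cases u
      · simp [coneD, expD, expMatrix_eq ha]
      · simp [coneD, expD, expMatrix_eq hb]
    rw [this, toLin'_apply, mulVec_smul, smul_mulVec, smul_smul, mul_comm]

theorem coneD_apply_mem (hν : 0 < ν) (ha : 0 < a) (hb : 0 < b) (w : FreeMonoid (Fin 3))
    {x : Fin 3 → ℝ} (hx : x ∈ expConvexCone) : coneD ν a b w x ∈ expConvexCone := by
  have hm : ![1, 1, 0] ∈ expConvexCone := Or.inl (by simp)
  have hsucc : ∀ (u : Fin 2) {x : Fin 3 → ℝ}, x ∈ expConvexCone →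
      coneD ν a b (FreeMonoid.of u.succ) x ∈ expConvexCone := by
    intro u x hx
    rw [← FreeMonoid.map_of, coneD_map_succ_apply ha hb]
    exact expConvexCone.smul_mem (by positivity) (expFlow_mulVec_mem hx)
  induction w using FreeMonoid.inductionOn' with
  | one => simpa using hx
  | of_mul u w ih =>
    rw [map_mul, Module.End.mul_apply]
    refine Fin.cases ?_ (fun u => hsucc u ih) u
    rw [coneD_zero_apply]
    have h := mem_expCone_iff.1 ih 0
    simp only [Real.exp_zero, one_mul, add_zero] at h
    rcases h.eq_or_lt with h | h
    · rw [← h, mul_zero, zero_smul]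
      exact Or.inr (by simp)
    · exact expConvexCone.smul_mem (mul_pos hν h) hm

/-- Flowing x for time s and then resetting evaluates the tangent functional of parameter s at x, up
to a positive factor; density and continuity give every s. -/
theorem mem_expCone_of_forall_nonneg (hν : 0 < ν) (ha : 0 < a) (hb : 0 < b)
    (hl : Dense (Set.range (wordSum ![Real.log a, Real.log b])))
    {π : Module.Dual ℝ (Fin 3 → ℝ)} (hπ : 0 < π ![1, 1, 0]) {x : Fin 3 → ℝ}
    (hx : ∀ w, 0 ≤ π (coneD ν a b w x)) : x ∈ expCone := by
  rw [mem_expCone_iff]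
  have hclosed : IsClosed {s : ℝ | 0 ≤ Real.exp s * x 0 - (1 + s) * x 1 - x 2} :=
    isClosed_le continuous_const (by fun_prop)
  refine fun s => hclosed.closure_subset_iff.2 ?_ (hl s)
  rintro _ ⟨w, rfl⟩
  have h := hx (FreeMonoid.of 0 * FreeMonoid.map Fin.succ w)
  rw [map_mul, Module.End.mul_apply, coneD_map_succ_apply ha hb, map_smul, map_smul,
    coneD_zero_apply, map_smul, smul_eq_mul, smul_eq_mul, mul_nonneg_iff_of_pos_left (by positivity),
    mul_nonneg_iff_of_pos_right hπ, mul_nonneg_iff_of_pos_left hν] at h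
  simp only [expFlow_mulVec, cons_val_zero, cons_val_one, cons_val] at h
  rw [Set.mem_ofPred_eq]
  linarith

theorem ConvexCone.smul_mem_of_nonneg_of_isClosed {E : Type*} [AddCommGroup E] [Module ℝ E]
    [TopologicalSpace E] [ContinuousSMul ℝ E] {C : ConvexCone ℝ E} (hC : IsClosed (C : Set E))
    {c : ℝ} (hc : 0 ≤ c) {x : E} (hx : x ∈ C) : c • x ∈ C := by
  have ht : Tendsto (fun s : ℝ => s • x) (𝓝[>] c) (𝓝 (c • x)) :=
    ((continuous_id.smul continuous_const).tendsto c).mono_left nhdsWithin_le_nhds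
  refine hC.mem_of_tendsto ht ?_
  filter_upwards [self_mem_nhdsWithin] with s hs
  exact C.smul_mem (hc.trans_lt hs) hx

/-- Resetting τ and then flowing gives positive multiples of (e^s, 1, s) for a dense set of s, hence
for all s. Rescaled limits as s → ∞ and s → -∞ add the directions (1,0,0) and (0,0,-1), and these
together generate the cone. -/
theorem expConvexCone_le (hν : 0 < ν) (ha : 0 < a) (hb : 0 < b)
    (hl : Dense (Set.range (wordSum ![Real.log a, Real.log b])))
    {τ : Fin 3 → ℝ} (hτ : 0 < τ 0 - τ 1 - τ 2) {C : ConvexCone ℝ (Fin 3 → ℝ)}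
    (hC : IsClosed (C : Set (Fin 3 → ℝ))) (h : ∀ w, coneD ν a b w τ ∈ C) :
    expConvexCone ≤ C := by
  have hcurve : ∀ s : ℝ, ![Real.exp s, 1, s] ∈ C := by
    have hclosed : IsClosed {s : ℝ | ![Real.exp s, 1, s] ∈ C} :=
      hC.preimage (f := fun s : ℝ => ![Real.exp s, 1, s]) <| continuous_pi fun i => by
        fin_cases i
        · exact Real.continuous_exp
        · exact continuous_const
        · exact continuous_id
    refine fun s => hclosed.closure_subset_iff.2 ?_ (hl s)
    rintro _ ⟨w, rfl⟩
    have hw := h (FreeMonoid.map Fin.succ w * FreeMonoid.of 0)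
    rw [map_mul, Module.End.mul_apply, coneD_zero_apply, map_smul,
      C.smul_mem_iff (mul_pos hν hτ), coneD_map_succ_apply ha hb,
      C.smul_mem_iff (by positivity), expFlow_mulVec] at hw
    simpa using hw
  have he0 : ![1, 0, 0] ∈ C := by
    have ht : Tendsto (fun s : ℝ => Real.exp (-s) • ![Real.exp s, 1, s]) atTop
        (𝓝 ![1, 0, 0]) := by
      rw [tendsto_pi_nhds]
      intro i
      fin_cases i
      · simp [← Real.exp_add]
      · simpa using Real.tendsto_exp_neg_atTop_nhds_zero
      · simpa [mul_comm] using Real.tendsto_pow_mul_exp_neg_atTop_nhds_zero 1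
    exact hC.mem_of_tendsto ht (.of_forall fun s => C.smul_mem (Real.exp_pos _) (hcurve s))
  have he2 : ![0, 0, -1] ∈ C := by
    have ht : Tendsto (fun s : ℝ => s⁻¹ • ![Real.exp (-s), 1, -s]) atTop
        (𝓝 ![0, 0, -1]) := by
      rw [tendsto_pi_nhds]
      intro i
      fin_cases i
      · simpa using tendsto_inv_atTop_zero.mul Real.tendsto_exp_neg_atTop_nhds_zero
      · simpa using tendsto_inv_atTop_zero
      · refine Tendsto.congr' ?_ tendsto_const_nhds
        filter_upwards [eventually_gt_atTop 0] with s hs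
        simp [hs.ne']
    refine hC.mem_of_tendsto ht ?_
    filter_upwards [eventually_gt_atTop 0] with s hs
    exact C.smul_mem (inv_pos.2 hs) (hcurve _)
  intro x hx
  rcases hx with ⟨h1, h⟩ | ⟨h1, h0, h2⟩
  · rw [le_div_iff₀ h1] at h
    have hx : x = x 1 • ![Real.exp (x 2 / x 1), 1, x 2 / x 1] +
        (x 0 - Real.exp (x 2 / x 1) * x 1) • ![1, 0, 0] := by
      ext i
      fin_cases i
      · simp; ring
      · simp
      · simp [mul_div_cancel₀ _ h1.ne']
    rw [hx]
    exact C.add_mem (C.smul_mem h1 (hcurve _))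
      (C.smul_mem_of_nonneg_of_isClosed hC (sub_nonneg.2 h) he0)
  · have hx : x = x 0 • ![1, 0, 0] + (-x 2) • ![0, 0, -1] := by
      ext i
      fin_cases i <;> simp [h1]
    rw [hx]
    exact C.add_mem (C.smul_mem_of_nonneg_of_isClosed hC h0 he0)
      (C.smul_mem_of_nonneg_of_isClosed hC (neg_nonneg.2 h2) he2)

end ExponentialCone

end

noncomputable section

/-! ### Regularity, choice of parameters and the realization -/

section Realization

open Matrix

/-- Reachability writes each x in V as a combination of the vectors D_w τ; the same combination in W
determines all π(D_v x), hence x by observability. This embeds V into W. -/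
theorem IsQuasiRealization.isRegular {α V : Type*} [Fintype α] [MeasurableSpace α]
    [AddCommGroup V] [Module ℝ V] {p : FreeMonoid α → ℝ} {π : Module.Dual ℝ V}
    {D : FreeMonoid α →* Module.End ℝ V} {τ : V} (h : IsQuasiRealization p π D τ)
    (hτ : Submodule.span ℝ (Set.range fun w => D w τ) = ⊤)
    (hπ : ∀ x, (∀ w, π (D w x) = 0) → x = 0) : IsRegularQuasiRealization p π D τ where
  toIsQuasiRealization := h
  minimal := by
    intro W _ _ π' D' τ' h'
    let f : (FreeMonoid α →₀ ℝ) →ₗ[ℝ] V := Finsupp.linearCombination ℝ fun w => D w τ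
    let g : (FreeMonoid α →₀ ℝ) →ₗ[ℝ] W := Finsupp.linearCombination ℝ fun w => D' w τ'
    have hf : LinearMap.range f = ⊤ := by rw [Finsupp.range_linearCombination, hτ]
    obtain ⟨s, hs⟩ := f.exists_rightInverse_of_surjective hf
    have heq : ∀ (v : FreeMonoid α) (c : FreeMonoid α →₀ ℝ), π (D v (f c)) = π' (D' v (g c)) := by
      intro v c
      simp only [f, g, Finsupp.linearCombination_apply, Finsupp.sum, map_sum, map_smul]
      refine Finset.sum_congr rfl fun w _ => ?_
      rw [← Module.End.mul_apply, ← map_mul, ← h.prob, h'.prob, map_mul, Module.End.mul_apply]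
    refine LinearMap.rank_le_of_injective (g ∘ₗ s) ?_
    rw [← LinearMap.ker_eq_bot, LinearMap.ker_eq_bot']
    intro x hx
    have hfs : f (s x) = x := LinearMap.congr_fun hs x
    rw [← hfs]
    refine hπ _ fun w => ?_
    rw [heq, show g (s x) = 0 from hx, map_zero, map_zero]

theorem IsQuasiRealization.of_nonneg {α V : Type*} [Fintype α] [Inhabited α] [MeasurableSpace α]
    [DiscreteMeasurableSpace α] [AddCommGroup V] [Module ℝ V] {π : Module.Dual ℝ V}
    {D : FreeMonoid α →* Module.End ℝ V} {τ : V} (h1 : π τ = 1)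
    (hπ : π ∘ₗ (∑ u : α, D (FreeMonoid.of u)) = π) (hτ : (∑ u : α, D (FreeMonoid.of u)) τ = τ)
    (h : ∀ w, 0 ≤ π (D w τ)) : IsQuasiRealization (fun w => π (D w τ)) π D τ where
  process := by
    refine isStationaryProcess_of_consistent h (by simpa using h1) (fun w => ?_) (fun w => ?_)
    · simp only [map_mul, Module.End.mul_apply]
      rw [← map_sum, ← map_sum, ← LinearMap.sum_apply, hτ]
    · simp only [map_mul, Module.End.mul_apply]
      rw [← map_sum, ← LinearMap.sum_apply, ← LinearMap.comp_apply, hπ]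
  left_fixed := hπ
  right_fixed := hτ
  prob _ := rfl

/-- The equations say that (P, Q, R) is a fixed vector normalized by ν μ₀ᵀτ = 1; here 7/2 = a + b.
The final inequality puts τ in the cone and π in its dual. -/
theorem exists_coneD_parameters : ∃ ν P Q R : ℝ, 0 < ν ∧ 0 < Q ∧ 0 < R ∧
    P * (1 - 7 / 2 * ν) = 1 ∧ Q * (1 - 2 * ν) = 1 ∧
    R * (1 - 2 * ν) = ν * (Real.log (1 / 2) + Real.log 3) * Q ∧ ν * (P - Q - R) = 1 ∧
    Q * Real.exp (R / Q) ≤ P := by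
  have hlog : Real.log (1 / 2) + Real.log 3 = Real.log (3 / 2) := by
    rw [← Real.log_mul (by norm_num) (by norm_num)]; norm_num
  rw [hlog]
  set L := Real.log (3 / 2) with hL
  have hL0 : 0 < L := Real.log_pos (by norm_num)
  have hL1 : L ≤ 1 / 2 := (Real.log_le_sub_one_of_pos (by norm_num)).trans (by norm_num)
  -- Solving for P, Q, R leaves the normalization g(ν) = 1. At ν = 1/4 both denominators are still
  -- positive and g = (6 - L)/4 exceeds 1.
  let g : ℝ → ℝ := fun ν => ν * (1 / (1 - 7 / 2 * ν) - 1 / (1 - 2 * ν) - ν * L / (1 - 2 * ν) ^ 2)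
  have hg : ContinuousOn g (Set.Icc 0 (1 / 4)) := by
    intro x hx
    have h1 : 1 - 7 / 2 * x ≠ 0 := by linarith [hx.2]
    have h2 : 1 - 2 * x ≠ 0 := by linarith [hx.2]
    have h3 : (1 - 2 * x) ^ 2 ≠ 0 := pow_ne_zero 2 h2
    refine ContinuousAt.continuousWithinAt ?_
    fun_prop (disch := assumption)
  obtain ⟨ν, ⟨hν0, hν1⟩, hν⟩ := intermediate_value_Icc (by norm_num) hg
    (show (1 : ℝ) ∈ Set.Icc (g 0) (g (1 / 4)) from by
      constructor
      · simp [g]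
      · simp only [g]; norm_num; linarith)
  have hνpos : 0 < ν := by
    refine hν0.lt_of_ne ?_
    rintro rfl
    simp [g] at hν
  have h1 : 0 < 1 - 7 / 2 * ν := by linarith
  have h2 : 0 < 1 - 2 * ν := by linarith
  refine ⟨ν, 1 / (1 - 7 / 2 * ν), 1 / (1 - 2 * ν), ν * L / (1 - 2 * ν) ^ 2, hνpos, by positivity,
    by positivity, one_div_mul_cancel h1.ne', one_div_mul_cancel h2.ne', by field_simp, hν, ?_⟩
  have hR : ν * L / (1 - 2 * ν) ^ 2 / (1 / (1 - 2 * ν)) = ν * L / (1 - 2 * ν) := by field_simp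
  rw [hR, one_div_mul_eq_div, div_le_div_iff₀ h2 h1, one_mul]
  have hle : ν * L / (1 - 2 * ν) ≤ 3 / 2 * ν / (1 - 2 * ν) := by
    exact div_le_div_of_nonneg_right (by nlinarith) h2.le
  -- The bound e^(-u) ≥ 1 - u at u = R/Q, with L ≤ 3/2.
  have h3 : (1 - 7 / 2 * ν) / (1 - 2 * ν) ≤ Real.exp (-(ν * L / (1 - 2 * ν))) := by
    refine le_trans ?_ (Real.add_one_le_exp _)
    have : (1 - 7 / 2 * ν) / (1 - 2 * ν) = -(3 / 2 * ν / (1 - 2 * ν)) + 1 := by field_simp; ring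
    linarith
  have h4 := mul_le_mul_of_nonneg_left h3 (Real.exp_pos (ν * L / (1 - 2 * ν))).le
  rw [← Real.exp_add, add_neg_cancel, Real.exp_zero, ← mul_div_assoc, div_le_one h2] at h4
  exact h4

theorem exists_coneD_realization : ∃ (ν a b : ℝ) (m₀ μ₀ : Fin 3 → ℝ), 0 < a ∧ 0 < b ∧
    ∃ (π : Module.Dual ℝ (Fin 3 → ℝ)) (τ : Fin 3 → ℝ) (p : FreeMonoid (Fin 3) → ℝ),
      Module.End.eigenspace (expDbar ν a b m₀ μ₀) 1 = Submodule.span ℝ {τ} ∧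
      Module.End.eigenspace (LinearMap.dualMap (expDbar ν a b m₀ μ₀)) 1
        = Submodule.span ℝ {π} ∧
      IsRegularQuasiRealization p π (expD ν a b m₀ μ₀) τ ∧
      (∃ K : ConvexCone ℝ (Fin 3 → ℝ), (K : Set (Fin 3 → ℝ)) = expCone ∧
        IsClosed (K : Set (Fin 3 → ℝ)) ∧ IsStableCone π (expD ν a b m₀ μ₀) τ K ∧
        ∀ C : ConvexCone ℝ (Fin 3 → ℝ), IsClosed (C : Set (Fin 3 → ℝ)) →
          IsStableCone π (expD ν a b m₀ μ₀) τ C → C = K) ∧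
      ¬ HasQuantumRealization p := by
  obtain ⟨ν, P, Q, R, hν, hQ, hR, hP1, hQ1, hR1, hPQR, hexp⟩ := exists_coneD_parameters
  set L := Real.log (1 / 2) + Real.log 3 with hL
  have ha : (0 : ℝ) < 1 / 2 := by norm_num
  have hb : (0 : ℝ) < 3 := by norm_num
  have hdense := dense_range_wordSum_log
  have hdiff : P - Q - R = ν⁻¹ := eq_inv_of_mul_eq_one_right hPQR
  have hdiff0 : 0 < P - Q - R := by rw [hdiff]; positivity
  have hbar : ∀ x, expDbar ν (1 / 2) 3 ![1, 1, 0] ![1, -1, -1] x =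
      ν • ![7 / 2 * x 0, 2 * x 1, L * x 1 + 2 * x 2] +
        (ν * (x 0 - x 1 - x 2)) • ![1, 1, 0] := by
    intro x
    have h1 := coneD_map_succ_apply (ν := ν) ha hb (FreeMonoid.of 0) x
    have h2 := coneD_map_succ_apply (ν := ν) ha hb (FreeMonoid.of 1) x
    rw [FreeMonoid.map_of, wordSum_of, expFlow_mulVec, FreeMonoid.length_of, pow_one] at h1 h2
    simp only [cons_val_zero, cons_val_one, Real.exp_log ha, Real.exp_log hb] at h1 h2
    rw [expDbar, LinearMap.sum_apply, Fin.sum_univ_three, coneD_zero_apply,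
      show (1 : Fin 3) = Fin.succ 0 from rfl, show (2 : Fin 3) = Fin.succ 1 from rfl, h1, h2]
    ext i
    fin_cases i
    · simp; ring
    · simp; ring
    · simp [L]; ring
  set τ : Fin 3 → ℝ := ![P, Q, R] with hτ
  -- The value of the unnormalized left eigenvector (P, -Q-R, -Q) on τ.
  let N : ℝ := P ^ 2 - Q ^ 2 - 2 * Q * R
  have hN : 0 < N := by
    have : P = Q + R + (P - Q - R) := by ring
    have : N = R ^ 2 + (P - Q - R) * (P + Q + R) := by simp only [N]; ring
    rw [this]
    have : 0 < P := by linarith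
    positivity
  let π₀ : Module.Dual ℝ (Fin 3 → ℝ) := Fintype.linearCombination ℝ ![P, -Q - R, -Q]
  let π : Module.Dual ℝ (Fin 3 → ℝ) := N⁻¹ • π₀
  have hπ₀ : ∀ x, π₀ x = P * x 0 - (Q + R) * x 1 - Q * x 2 := by
    intro x
    simp [π₀, Fintype.linearCombination_apply, Fin.sum_univ_three]
    ring
  have hπτ : π τ = 1 := by
    have : π₀ τ = N := by
      rw [hπ₀]; simp [τ, N]; ring
    simp [π, this, hN.ne']
  have hmτ : τ 0 - τ 1 - τ 2 = P - Q - R := by simp [τ]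
  have hπm : 0 < π ![1, 1, 0] := by
    have : π₀ ![1, 1, 0] = P - Q - R := by rw [hπ₀]; simp; ring
    simp only [π, LinearMap.smul_apply, this, smul_eq_mul]
    positivity
  have hτfix : expDbar ν (1 / 2) 3 ![1, 1, 0] ![1, -1, -1] τ = τ := by
    rw [hbar, hmτ, hPQR]
    ext i
    fin_cases i <;> simp [τ] <;> linarith
  have hπfix : π ∘ₗ expDbar ν (1 / 2) 3 ![1, 1, 0] ![1, -1, -1] = π := by
    refine LinearMap.ext fun x => ?_
    rw [LinearMap.comp_apply, hbar]
    simp only [π, LinearMap.smul_apply, hπ₀]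
    congr 1
    simp
    linear_combination (x 0 - x 1 - x 2) * hPQR - x 0 * hP1 + x 1 * (hQ1 + hR1) + x 2 * hQ1
  -- Unnormalized, π is Q times the tangent functional at s = R/Q plus the nonnegative multiple P -
  -- Q e^(R/Q) of the first coordinate.
  have hπK : ∀ x ∈ expConvexCone, 0 ≤ π x := by
    intro x hx
    have h0 := nonneg_of_mem_expCone hx
    have h := mul_nonneg hQ.le (mem_expCone_iff.1 hx (R / Q))
    have h1 := mul_le_mul_of_nonneg_right hexp h0
    have h2 : Q * (R / Q) = R := mul_div_cancel₀ _ hQ.ne'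
    simp only [π, LinearMap.smul_apply, smul_eq_mul, hπ₀]
    refine mul_nonneg (inv_nonneg.2 hN.le) ?_
    have h3 : Q * (Real.exp (R / Q) * x 0 - (1 + R / Q) * x 1 - x 2) =
        Q * Real.exp (R / Q) * x 0 - (Q + Q * (R / Q)) * x 1 - Q * x 2 := by ring
    rw [h3, h2] at h
    linarith
  have hτK : τ ∈ expConvexCone := by
    refine Or.inl ⟨hQ, ?_⟩
    show Real.exp (R / Q) ≤ P / Q
    rw [le_div_iff₀ hQ]
    linarith
  have hstable : IsStableCone π (coneD ν (1 / 2) 3) τ expConvexCone :=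
    ⟨hτK, fun w x hx => coneD_apply_mem hν ha hb w hx, hπK⟩
  have hle : ∀ C : ConvexCone ℝ (Fin 3 → ℝ), IsClosed (C : Set (Fin 3 → ℝ)) →
      (∀ w, coneD ν (1 / 2) 3 w τ ∈ C) → expConvexCone ≤ C := fun C hC h =>
    expConvexCone_le hν ha hb hdense (by rwa [hmτ]) hC h
  refine ⟨ν, 1 / 2, 3, ![1, 1, 0], ![1, -1, -1], ha, hb, π, τ,
    fun w => π (coneD ν (1 / 2) 3 w τ), ?_, ?_, ?_,
    ⟨expConvexCone, rfl, isClosed_expCone, hstable, ?_⟩, ?_⟩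
  -- Because the reset has rank one, a fixed vector is determined by the scalar c = μ₀ᵀx: the
  -- remaining triangular system is invertible.
  · refine le_antisymm (fun x hx => ?_) ?_
    · rw [Module.End.mem_eigenspace_iff, one_smul, hbar] at hx
      set c := x 0 - x 1 - x 2
      have h0 := congrFun hx 0
      have h1 := congrFun hx 1
      have h2 := congrFun hx 2
      simp at h0 h1 h2
      have e0 : x 0 = ν * c * P := by linear_combination -x 0 * hP1 - P * h0
      have e1 : x 1 = ν * c * Q := by linear_combination -x 1 * hQ1 - Q * h1
      have e2 : x 2 = ν * c * R := by
        linear_combination -(x 2 - ν * c * R) * hQ1 + Q * (-h2 + ν * L * e1 - ν * c * hR1)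
      refine Submodule.mem_span_singleton.2 ⟨ν * c, ?_⟩
      ext i
      fin_cases i
      exacts [e0.symm, e1.symm, e2.symm]
    · rw [Submodule.span_singleton_le_iff_mem, Module.End.mem_eigenspace_iff, one_smul]
      exact hτfix
  · refine le_antisymm (fun f hf => ?_) ?_
    · rw [Module.End.mem_eigenspace_iff, one_smul] at hf
      have hf' : ∀ x, f (ν • ![7 / 2 * x 0, 2 * x 1, L * x 1 + 2 * x 2] +
          (ν * (x 0 - x 1 - x 2)) • ![1, 1, 0]) = f x := fun x => by
        rw [← hbar]
        exact LinearMap.congr_fun hf x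
      have hval : ∀ x y z, f ![x, y, z] =
          x * f ![1, 0, 0] + y * f ![0, 1, 0] + z * f ![0, 0, 1] := by
        intro x y z
        simp only [← smul_eq_mul, ← map_smul, ← map_add]
        congr 1
        ext i
        fin_cases i <;> simp
      set c := f ![1, 1, 0] with hc
      have h0 := hf' ![1, 0, 0]
      have h1 := hf' ![0, 1, 0]
      have h2 := hf' ![0, 0, 1]
      simp only [map_add, map_smul, ← hc] at h0 h1 h2
      rw [hval] at h0 h1 h2
      simp at h0 h1 h2
      have e0 : f ![1, 0, 0] = ν * c * P := by
        linear_combination -f ![1, 0, 0] * hP1 - P * h0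
      have e2 : f ![0, 0, 1] = -(ν * c * Q) := by
        linear_combination -f ![0, 0, 1] * hQ1 - Q * h2
      have e1 : f ![0, 1, 0] = -(ν * c * (Q + R)) := by
        linear_combination (-f ![0, 1, 0] - ν * c * R) * hQ1 + Q * (-h1 + ν * L * e2 + ν * c * hR1)
      refine Submodule.mem_span_singleton.2 ⟨ν * c * N, LinearMap.ext fun x => ?_⟩
      have hx : x = ![x 0, x 1, x 2] := by
        ext i
        fin_cases i <;> rfl
      rw [LinearMap.smul_apply, LinearMap.smul_apply, hπ₀, smul_eq_mul, smul_eq_mul, ← mul_assoc,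
        mul_assoc (ν * c), mul_inv_cancel₀ hN.ne']
      conv_rhs => rw [hx, hval, e0, e1, e2]
      ring
    · rw [Submodule.span_singleton_le_iff_mem, Module.End.mem_eigenspace_iff, one_smul]
      exact hπfix
  · refine (IsQuasiRealization.of_nonneg hπτ hπfix hτfix fun w =>
      hπK _ (coneD_apply_mem hν ha hb w hτK)).isRegular ?_ ?_
    · rw [eq_top_iff]
      let S := Submodule.span ℝ (Set.range fun w => coneD ν (1 / 2) 3 w τ)
      -- The span of the orbit is itself a closed cone containing the orbit, so it contains the
      -- exponential cone, which spans.
      have hS : expConvexCone ≤ S.toConvexCone :=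
        hle _ S.closed_of_finiteDimensional fun w => Submodule.subset_span ⟨w, rfl⟩
      have h0 : ![1, 0, 0] ∈ S := hS (Or.inr (by simp))
      have h1 : ![1, 1, 0] ∈ S := hS (Or.inl (by simp))
      have h2 : ![0, 0, -1] ∈ S := hS (Or.inr (by simp))
      intro x _
      have hx : x = (x 0 - x 1) • ![1, 0, 0] + x 1 • ![1, 1, 0] + (-x 2) • ![0, 0, -1] := by
        ext i
        fin_cases i <;> simp
      rw [hx]
      exact add_mem (add_mem (S.smul_mem _ h0) (S.smul_mem _ h1)) (S.smul_mem _ h2)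
    · intro x hx
      -- An unobservable x passes the membership test with both signs, and the cone is pointed.
      refine eq_zero_of_mem_expCone_of_neg_mem
        (mem_expCone_of_forall_nonneg hν ha hb hdense hπm fun w => (hx w).ge)
        (mem_expCone_of_forall_nonneg hν ha hb hdense hπm fun w => ?_)
      rw [map_neg, map_neg, hx w, neg_zero]
  · intro C hC hs
    refine le_antisymm (fun x hx => ?_) (hle C hC fun w => hs.map_mem w _ hs.mem)
    exact mem_expCone_of_forall_nonneg hν ha hb hdense hπm fun w =>
      hs.dual _ (hs.map_mem w x hx)
  · refine not_hasQuantumRealization (ν := ν)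
      (κ := ν ^ 2 * (P - Q - R) * π ![1, 1, 0]) hν (by positivity) hdense fun w => ?_
    simp only [map_mul, Module.End.mul_apply]
    rw [coneD_zero_apply τ, coneD_map_succ_apply ha hb, mulVec_smul, map_smul, map_smul,
      map_smul, map_smul, coneD_zero_apply, map_smul, expFlow_mulVec, hmτ]
    simp
    ring

end Realization

end

noncomputable section

/-! ### The exponential cone is not semi-algebraic -/

section Semialgebraic

open Filter Topology

theorem Polynomial.exists_eventually_le_abs_eval {c : Polynomial ℝ} (hc : c ≠ 0) :
    ∃ δ > 0, ∀ᶠ s in atTop, δ ≤ |c.eval s| := by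
  by_cases hdeg : 0 < c.degree
  · exact ⟨1, one_pos, (c.abs_tendsto_atTop hdeg).eventually_ge_atTop 1⟩
  · have h := eq_C_of_degree_le_zero (not_lt.1 hdeg)
    have h0 : c.coeff 0 ≠ 0 := by
      intro h0
      rw [h0, C_0] at h
      exact hc h
    refine ⟨|c.coeff 0|, abs_pos.2 h0, .of_forall fun s => ?_⟩
    rw [h]
    simp

/-- Induction on the degree in e^s: write G = H·X + G₀. A lower bound δ on |H| makes |H| e^s
dominate the polynomial G₀(s), so a bound away from zero is the statement that propagates. -/
theorem Polynomial.exists_eventually_le_abs_evalEval_exp {G : Polynomial (Polynomial ℝ)}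
    (hG : G ≠ 0) : ∃ δ > 0, ∀ᶠ s in atTop, δ ≤ |G.evalEval s (Real.exp s)| := by
  induction hn : G.natDegree using Nat.strong_induction_on generalizing G with
  | _ n ih =>
  have hdecomp := G.divX_mul_X_add
  by_cases hH : G.divX = 0
  · rw [hH, zero_mul, zero_add] at hdecomp
    have hc : G.coeff 0 ≠ 0 := by
      intro h0
      rw [h0, C_0] at hdecomp
      exact hG hdecomp.symm
    obtain ⟨δ, hδ, h⟩ := exists_eventually_le_abs_eval hc
    refine ⟨δ, hδ, h.mono fun s hs => ?_⟩
    rwa [← hdecomp, evalEval_C]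
  · have hdeg : G.natDegree ≠ 0 := fun h0 => hH (divX_eq_zero_iff.2 (eq_C_of_natDegree_eq_zero h0))
    obtain ⟨δ, hδ, h⟩ := ih _ (by rw [← hn, natDegree_divX_eq_natDegree_tsub_one]; omega) hH rfl
    have hsmall : ∀ᶠ s in atTop, |(G.coeff 0).eval s / Real.exp s| < δ / 2 := by
      have := (G.coeff 0).tendsto_div_exp_atTop.abs
      rw [abs_zero] at this
      exact this.eventually_lt_const (half_pos hδ)
    refine ⟨δ / 2, half_pos hδ, ?_⟩
    filter_upwards [h, hsmall, eventually_ge_atTop 0] with s h1 h2 h3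
    have hexp : 1 ≤ Real.exp s := Real.one_le_exp h3
    rw [abs_div, abs_of_pos (Real.exp_pos s), div_lt_iff₀ (Real.exp_pos s)] at h2
    rw [← hdecomp, evalEval_add, evalEval_mul, evalEval_X, evalEval_C]
    have h4 := abs_sub_abs_le_abs_sub (G.divX.evalEval s (Real.exp s) * Real.exp s)
      (-(G.coeff 0).eval s)
    rw [abs_mul, abs_of_pos (Real.exp_pos s), abs_neg, sub_neg_eq_add] at h4
    nlinarith

theorem eventually_eval_exp_ne_zero_or (f : MvPolynomial (Fin 3) ℝ) :
    (∀ x s : ℝ, MvPolynomial.eval ![x, 1, s] f = 0) ∨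
      ∀ᶠ s in atTop, MvPolynomial.eval ![Real.exp s, 1, s] f ≠ 0 := by
  let G : Polynomial (Polynomial ℝ) := MvPolynomial.eval₂Hom (Polynomial.C.comp Polynomial.C)
    ![Polynomial.X, 1, Polynomial.C Polynomial.X] f
  have hG : ∀ x s : ℝ, G.evalEval s x = MvPolynomial.eval ![x, 1, s] f := by
    intro x s
    have : (Polynomial.evalEvalRingHom s x).comp
        (MvPolynomial.eval₂Hom (Polynomial.C.comp Polynomial.C)
          ![Polynomial.X, 1, Polynomial.C Polynomial.X]) = MvPolynomial.eval ![x, 1, s] := by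
      refine MvPolynomial.ringHom_ext (fun r => ?_) fun i => ?_
      · simp
      · fin_cases i <;> simp
    exact RingHom.congr_fun this f
  by_cases h : G = 0
  · left
    intro x s
    rw [← hG, h, Polynomial.evalEval_zero]
  · right
    obtain ⟨δ, hδ, hs⟩ := Polynomial.exists_eventually_le_abs_evalEval_exp h
    filter_upwards [hs] with s hs
    rw [← hG, ← abs_pos]
    exact hδ.trans_le hs

/-- The property is stable under Boolean operations. For {f > 0}, either f vanishes on the whole
plane x₂ = 1, or it is eventually nonzero on the curve and keeps its sign nearby. -/
theorem IsSemialgebraic.eventually_locally_constant {S : Set (Fin 3 → ℝ)}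
    (hS : IsSemialgebraic S) :
    ∀ᶠ s in atTop, ∀ᶠ x in 𝓝 (Real.exp s), (![x, 1, s] ∈ S ↔ ![Real.exp s, 1, s] ∈ S) := by
  induction hS using BooleanSubalgebra.closure_bot_sup_induction with
  | mem S hS =>
    obtain ⟨f, rfl⟩ := hS
    rcases eventually_eval_exp_ne_zero_or f with h | h
    · simp [h]
    · filter_upwards [h] with s hs
      have hcont : Continuous fun x : ℝ => MvPolynomial.eval ![x, 1, s] f :=
        (MvPolynomial.continuous_eval f).comp <| continuous_pi fun i => by
          fin_cases i
          · exact continuous_id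
          · exact continuous_const
          · exact continuous_const
      rcases hs.lt_or_gt with hs | hs
      · filter_upwards [hcont.continuousAt.eventually_lt_const hs] with x hx
        simp [hx.not_gt, hs.not_gt]
      · filter_upwards [hcont.continuousAt.eventually_const_lt hs] with x hx
        simp [hx, hs]
  | bot => simp
  | sup S _ T _ hS hT =>
    filter_upwards [hS, hT] with s hS hT
    filter_upwards [hS, hT] with x hS hT
    exact or_congr hS hT
  | compl S _ hS =>
    filter_upwards [hS] with s hS
    filter_upwards [hS] with x hS
    exact not_congr hS

/-- On each line (x, 1, s) membership changes exactly at x = e^s. -/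
theorem not_isSemialgebraic_expCone : ¬ IsSemialgebraic expCone := by
  intro h
  obtain ⟨s, hs⟩ := h.eventually_locally_constant.exists
  have hmem : ∀ x : ℝ, ![x, 1, s] ∈ expCone ↔ Real.exp s ≤ x := fun x => by simp [expCone]
  have hlt : ∃ᶠ x in 𝓝 (Real.exp s), x < Real.exp s := frequently_lt_nhds _
  obtain ⟨x, hx, hx'⟩ := (hlt.and_eventually hs).exists
  rw [hmem, hmem] at hx'
  exact hx.not_ge (hx'.2 le_rfl)

end Semialgebraic

end

theorem theorem3 :
    (∃ (ν a b : ℝ) (m₀ μ₀ : Fin 3 → ℝ), 0 < a ∧ 0 < b ∧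
      ∃ (π : Module.Dual ℝ (Fin 3 → ℝ)) (τ : Fin 3 → ℝ) (p : FreeMonoid (Fin 3) → ℝ),
        -- `τ` and `π` are the right and left eigenvectors for the eigenvalue 1, unique up to scale
        Module.End.eigenspace (expDbar ν a b m₀ μ₀) 1 = Submodule.span ℝ {τ} ∧
        Module.End.eigenspace (LinearMap.dualMap (expDbar ν a b m₀ μ₀)) 1
          = Submodule.span ℝ {π} ∧
        IsRegularQuasiRealization p π (expD ν a b m₀ μ₀) τ ∧
        (∃ K : ConvexCone ℝ (Fin 3 → ℝ), (K : Set (Fin 3 → ℝ)) = expCone ∧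
          IsClosed (K : Set (Fin 3 → ℝ)) ∧ IsStableCone π (expD ν a b m₀ μ₀) τ K ∧
          ∀ C : ConvexCone ℝ (Fin 3 → ℝ), IsClosed (C : Set (Fin 3 → ℝ)) →
            IsStableCone π (expD ν a b m₀ μ₀) τ C → C = K) ∧
        ¬ HasQuantumRealization p) ∧
    ¬ IsSemialgebraic expCone :=
  ⟨exists_coneD_realization, not_isSemialgebraic_expCone⟩
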